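/- **Setting.** Fix $T>0$ and an i.i.d. sequence $(a_j)_{j\in\mathbb Z}$ of zero-mean symbols $\pm1$ (BPSK; its kurtosis is $\kappa=-2$). For $\gamma\in[0,1)$ let $B_\gamma=[-\frac{1+\gamma}{2T},\frac{1+\gamma}{2T}]$ and let $\mathcal F(B_\gamma)$ be the space of functions of $L^2(\mathbb R)$ whose Fourier transform vanishes outside $B_\gamma$. For each $\gamma\in[0,1)$ let $g_\gamma\in\mathcal F(B_\gamma)$ be a shaping filter with $\hat g_\gamma\neq0$ almost everywhere on $B_\gamma$, let $T_e=T_e(\gamma)$ be a sampling period with $0<T_e<T/(1+\gamma)$ and $T_e\notin\{T,\frac T2,\frac T3,\frac{2T}3\}$, and let $s(n)=s_\gamma(n)=\sum_{j\in\mathbb Z}a_j\,g_\gamma(nT_e-jT)$ (in mean square). Put $\alpha=T_e/T$. Write $\langle u_n\rangle=\lim_N\frac1{2N+1}\sum_{n=-N}^N u_n$. For a signal $x$ put $R_x^{(\alpha)}(m)=\langle \mathbb E[x(n+m)x(n)^*]e^{-2i\pi n\alpha}\rangle$ and $R_{c,x}^{(\alpha)}(m)=\langle \mathbb E[x(n+m)x(n)]e^{-2i\pi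 n\alpha}\rangle$, let $c_4(x)=\mathrm{cum}\{x,x^*,x,x^*\}$, and put $$\beta'(x)=\langle c_4(x(n))\rangle+2+2\sum_{l=\pm1}|R_x^{(l\alpha)}(0)|^2+\sum_{l=\pm1}|R_{c,x}^{(l\alpha)}(0)|^2 .$$ Let $S$ be the spectral density of $s$, i.e. $R^{(0)}_s(m)=\int_{-1/2}^{1/2}S(\nu)e^{2i\pi m\nu}d\nu$ for all $m\in\mathbb Z$. A filter is a transfer function $f$ with $\|f\|^2=\int_{-1/2}^{1/2}|f(e^{2i\pi\nu})|^2S(\nu)\,d\nu<\infty$; its output $[f(z)]s$ is the mean-square limit of the outputs of finite impulse response filters that converge to $f$ for this norm. Define $$\beta'_{\min}(\gamma)=\inf_{\|f\|=1}\beta'([f(z)]s),\qquad \eta_{\min}(\gamma)=\inf_{\|f\|=1}\langle c_4([f(z)]s(n))\rangle .$$ For $f_a\in\mathcal F(B_\gamma)$, $f_a\ne0$, put $$\Psi(f_a)=\kappa T\frac{\int|f_a|^4dt}{(\int|f_a|^2dt)^2},$$ $$\Phi'(f_a)=\Psi(f_a)+2+4\left|\frac{\int|f_a|^2e^{-2i\pi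 t/T}dt}{\int|f_a|^2dt}\right|^2+\frac{|\int f_a^2e^{-2i\pi t/T}dt|^2}{(\int|f_a|^2dt)^2}+\frac{|\int f_a^2e^{2i\pi t/T}dt|^2}{(\int|f_a|^2dt)^2}.$$ **Proposition.** For every $\gamma\in[0,1)$ the series defining the signal converges, the spectral density of $s$ exists, for every filter with $\|f\|=1$ all moments and time averages in $\beta'([f(z)]s)$ exist, and the two infima above are finite. Moreover: 1. for every $\gamma\in[0,1)$, $$\beta'_{\min}(\gamma)=\inf_{f_a\in\mathcal F(B_\gamma),\,f_a\ne0}\Phi'(f_a),\qquad \eta_{\min}(\gamma)=\inf_{f_a\in\mathcal F(B_\gamma),\,f_a\neq0}\Psi(f_a);$$ 2. $\gamma\mapsto\beta'_{\min}(\gamma)$ is decreasing (in the wide sense) on $[0,1)$; 3. $\beta'_{\min}(0)=\eta_{\min}(0)+2$; 4. $\beta'_{\min}(\gamma)<\frac12$ for all $\gamma\in[0,1)$ if and only if $\beta'_{\min}(0)<\frac12$. -/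

import Mathlib

open MeasureTheory ProbabilityTheory Filter Topology Set
open scoped ComplexConjugate

noncomputable section

namespace BPSK

/-! Band-limited functions and the functionals on them -/

/-- The frequency interval `[-(1+γ)/(2T), (1+γ)/(2T)]`. -/
def band (T γ : ℝ) : Set ℝ := Icc (-((1 + γ) / (2 * T))) ((1 + γ) / (2 * T))

/-- `F` is square integrable, vanishes outside `B`, and `f` is its inverse Fourier transform
`f(t) = ∫_B e^{2iπνt} F(ν) dν`; in other words `F` is the Fourier transform of `f`. -/
structure HasSpectrumIn (B : Set ℝ) (f F : ℝ → ℂ) : Prop where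
  memLp : MemLp F 2 volume
  eq_zero : ∀ ν, ν ∉ B → F ν = 0
  inversion : ∀ t : ℝ, f t = ∫ ν in B, Complex.exp (2 * Real.pi * Complex.I * ν * t) * F ν

/-- The space of square integrable functions whose Fourier transform is zero outside `B`
(each one given by its continuous representative). -/
def bandLimited (B : Set ℝ) : Set (ℝ → ℂ) :=
  {f | MemLp f 2 volume ∧ ∃ F, HasSpectrumIn B f F}

/-- A shaping filter with bandwidth `B`: band-limited to `B`, and its Fourier transform does not
vanish on a subset of `B` of positive measure. -/
def IsShapingFilter (B : Set ℝ) (g : ℝ → ℂ) : Prop :=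
  MemLp g 2 volume ∧ ∃ G, HasSpectrumIn B g G ∧ ∀ᵐ ν ∂(volume.restrict B), G ν ≠ 0

/-- `∫ |f(t)|² dt`. -/
def energy (f : ℝ → ℂ) : ℝ := ∫ t, ‖f t‖ ^ 2

/-- The kurtosis of the symbols `±1`. -/
def kappa : ℝ := -2

/-- `κ T ∫|f|⁴ / (∫|f|²)²`. -/
def Psi (T : ℝ) (f : ℝ → ℂ) : ℝ := kappa * T * ((∫ t, ‖f t‖ ^ 4) / energy f ^ 2)

/-- The functional `Φ'`. -/
def PhiPrime (T : ℝ) (f : ℝ → ℂ) : ℝ :=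
  Psi T f + 2
    + 4 * ‖(∫ t : ℝ, ((‖f t‖ ^ 2 : ℝ) : ℂ) * Complex.exp (-(2 * Real.pi * Complex.I * (t / T))))
        / (energy f : ℂ)‖ ^ 2
    + ‖∫ t : ℝ, f t ^ 2 * Complex.exp (-(2 * Real.pi * Complex.I * (t / T)))‖ ^ 2 / energy f ^ 2
    + ‖∫ t : ℝ, f t ^ 2 * Complex.exp (2 * Real.pi * Complex.I * (t / T))‖ ^ 2 / energy f ^ 2

/-! Time averages -/

/-- `(1 / (2N+1)) ∑_{n=-N}^{N} u_n`. -/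
def partialAvg {E : Type*} [AddCommGroup E] [Module ℝ E] (u : ℤ → E) (N : ℕ) : E :=
  (1 / (2 * (N : ℝ) + 1)) • ∑ n ∈ Finset.Icc (-(N : ℤ)) (N : ℤ), u n

/-- The limit defining the time average exists. -/
def TimeAvgExists {E : Type*} [NormedAddCommGroup E] [NormedSpace ℝ E] (u : ℤ → E) : Prop :=
  ∃ L : E, Tendsto (partialAvg u) atTop (𝓝 L)

/-- The time average `<u_n> = lim_{N → ∞} (1 / (2N+1)) ∑_{n=-N}^{N} u_n`. -/
def timeAvg {E : Type*} [NormedAddCommGroup E] [NormedSpace ℝ E] (u : ℤ → E) : E :=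
  limUnder atTop (partialAvg u)

section Signals

variable {Ω : Type*} [MeasurableSpace Ω] {μ : Measure Ω}

/-! Statistics of discrete-time signals -/

/-- `cum{x, x*, x, x*}`, computed on the centred variable (cumulants of order `≥ 2` are invariant
under translation). -/
def cum4 (μ : Measure Ω) (X : Ω → ℂ) : ℝ :=
  (∫ ω, ‖X ω - ∫ ω', X ω' ∂μ‖ ^ 4 ∂μ)
    - 2 * (∫ ω, ‖X ω - ∫ ω', X ω' ∂μ‖ ^ 2 ∂μ) ^ 2
    - ‖∫ ω, (X ω - ∫ ω', X ω' ∂μ) ^ 2 ∂μ‖ ^ 2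

/-- The sequence `n ↦ E(x(n+m) x(n)^*) e^{-2iπnα}`. -/
def cyclicCorrSeq (x : ℤ → Lp ℂ 2 μ) (α : ℝ) (m : ℤ) (n : ℤ) : ℂ :=
  (∫ ω, x (n + m) ω * conj (x n ω) ∂μ) * Complex.exp (-(2 * Real.pi * Complex.I * n * α))

/-- The sequence `n ↦ E(x(n+m) x(n)) e^{-2iπnα}`. -/
def nonConjCorrSeq (x : ℤ → Lp ℂ 2 μ) (α : ℝ) (m : ℤ) (n : ℤ) : ℂ :=
  (∫ ω, x (n + m) ω * x n ω ∂μ) * Complex.exp (-(2 * Real.pi * Complex.I * n * α))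

/-- The cyclo-correlation `R_x^{(α)}(m)`. -/
def cyclicCorr (x : ℤ → Lp ℂ 2 μ) (α : ℝ) (m : ℤ) : ℂ := timeAvg (cyclicCorrSeq x α m)

/-- The non conjugate cyclo-correlation `R_{c,x}^{(α)}(m)`. -/
def nonConjCorr (x : ℤ → Lp ℂ 2 μ) (α : ℝ) (m : ℤ) : ℂ := timeAvg (nonConjCorrSeq x α m)

/-- `<c₄(x(n))>`. -/
def avgCum4 (x : ℤ → Lp ℂ 2 μ) : ℝ := timeAvg fun n => cum4 μ (x n)

/-- `β'(x)`, for a signal `x` of (normalised) baud rate `α`. -/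
def betaPrime (α : ℝ) (x : ℤ → Lp ℂ 2 μ) : ℝ :=
  avgCum4 x + 2
    + 2 * (‖cyclicCorr x (-α) 0‖ ^ 2 + ‖cyclicCorr x α 0‖ ^ 2)
    + (‖nonConjCorr x (-α) 0‖ ^ 2 + ‖nonConjCorr x α 0‖ ^ 2)

/-- All the expectations and time averages that occur in `betaPrime α x` exist. -/
def BetaPrimeExists (α : ℝ) (x : ℤ → Lp ℂ 2 μ) : Prop :=
  (∀ n, MemLp (x n) 4 μ) ∧ TimeAvgExists (fun n => cum4 μ (x n)) ∧
    TimeAvgExists (cyclicCorrSeq x (-α) 0) ∧ TimeAvgExists (cyclicCorrSeq x α 0) ∧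
    TimeAvgExists (nonConjCorrSeq x (-α) 0) ∧ TimeAvgExists (nonConjCorrSeq x α 0)

/-- `S` is a spectral density of `x` on `[-1/2, 1/2]`: it is nonnegative and integrable and
`R_x^{(0)}(m) = ∫_{-1/2}^{1/2} S(ν) e^{2iπmν} dν` for every lag `m`. -/
structure IsSpectralDensity (x : ℤ → Lp ℂ 2 μ) (S : ℝ → ℝ) : Prop where
  nonneg : ∀ ν, 0 ≤ S ν
  integrable : IntervalIntegrable S volume (-(1 / 2)) (1 / 2)
  avgExists : ∀ m, TimeAvgExists (cyclicCorrSeq x 0 m)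
  corr : ∀ m : ℤ, cyclicCorr x 0 m =
    ∫ ν in (-(1 / 2) : ℝ)..(1 / 2), (S ν : ℂ) * Complex.exp (2 * Real.pi * Complex.I * m * ν)

open Classical in
/-- The spectral density of `x` (determined up to a null set), and `0` if there is none. -/
def spectralDensity (x : ℤ → Lp ℂ 2 μ) : ℝ → ℝ :=
  if h : ∃ S, IsSpectralDensity x S then h.choose else 0

/-! Filters. A transfer function is written as the function `ν ↦ f(e^{2iπν})` on `[-1/2, 1/2]`. -/

/-- The transfer function `∑_l h_l e^{-2iπlν}` of the finite impulse response `h`. -/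
def firTransfer (h : ℤ →₀ ℂ) (ν : ℝ) : ℂ :=
  h.sum fun l c => c * Complex.exp (-(2 * Real.pi * Complex.I * l * ν))

/-- The output `∑_l h_l x(n-l)` of the filter with finite impulse response `h`. -/
def firOutput (h : ℤ →₀ ℂ) (x : ℤ → Lp ℂ 2 μ) (n : ℤ) : Lp ℂ 2 μ :=
  h.sum fun l c => c • x (n - l)

/-- `‖f‖² = ∫_{-1/2}^{1/2} |f(e^{2iπν})|² S_x^{(0)}(e^{2iπν}) dν`. -/
def filterNormSq (x : ℤ → Lp ℂ 2 μ) (f : ℝ → ℂ) : ℝ :=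
  ∫ ν in (-(1 / 2) : ℝ)..(1 / 2), ‖f ν‖ ^ 2 * spectralDensity x ν

/-- `‖f‖ < ∞`. -/
def FiniteFilterNorm (x : ℤ → Lp ℂ 2 μ) (f : ℝ → ℂ) : Prop :=
  Measurable f ∧
    IntervalIntegrable (fun ν => ‖f ν‖ ^ 2 * spectralDensity x ν) volume (-(1 / 2)) (1 / 2)

/-- `r(n) = [f(z)]x(n)` for a transfer function of finite norm: `f` is the limit, for the norm of
filters, of finite impulse response filters whose outputs converge to `r` in mean square. -/
def IsFilterOutput (x : ℤ → Lp ℂ 2 μ) (f : ℝ → ℂ) (r : ℤ → Lp ℂ 2 μ) : Prop :=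
  FiniteFilterNorm x f ∧ ∃ h : ℕ → (ℤ →₀ ℂ),
    Tendsto (fun k => filterNormSq x fun ν => f ν - firTransfer (h k) ν) atTop (𝓝 0) ∧
    ∀ n, Tendsto (fun k => firOutput (h k) x n) atTop (𝓝 (r n))

/-- The signals `[f(z)]x(n)` with `‖f‖ = 1`. -/
def unitFiltered (x : ℤ → Lp ℂ 2 μ) : Set (ℤ → Lp ℂ 2 μ) :=
  {r | ∃ f : ℝ → ℂ, filterNormSq x f = 1 ∧ IsFilterOutput x f r}

/-- `β'_min`, the infimum of `β'([f(z)]x)` over `‖f‖ = 1`. -/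
def betaPrimeMin (α : ℝ) (x : ℤ → Lp ℂ 2 μ) : ℝ := sInf (betaPrime α '' unitFiltered x)

/-- `η_min`, the infimum of `<c₄([f(z)]x)>` over `‖f‖ = 1`. -/
def etaMin (x : ℤ → Lp ℂ 2 μ) : ℝ := sInf (avgCum4 '' unitFiltered x)

/-! The linearly modulated BPSK signal -/

/-- An i.i.d. zero mean sequence of symbols `±1`. -/
structure IsBPSK (μ : Measure Ω) (a : ℤ → Ω → ℝ) : Prop where
  measurable : ∀ n, Measurable (a n)
  indep : iIndepFun a μ
  values : ∀ n, ∀ᵐ ω ∂μ, a n ω = 1 ∨ a n ω = -1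
  mean : ∀ n, ∫ ω, a n ω ∂μ = 0

theorem IsBPSK.memLp [IsProbabilityMeasure μ] {a : ℤ → Ω → ℝ} (ha : IsBPSK μ a) (n : ℤ) :
    MemLp (fun ω => (a n ω : ℂ)) 2 μ := by
  refine MemLp.of_bound (Complex.measurable_ofReal.comp (ha.measurable n)).aestronglyMeasurable 1 ?_
  filter_upwards [ha.values n] with ω h
  rcases h with h | h <;> simp [h]

variable [IsProbabilityMeasure μ]

/-- The symbol `a_n` as an element of `L²(Ω)`. -/
def symbol {a : ℤ → Ω → ℝ} (ha : IsBPSK μ a) (n : ℤ) : Lp ℂ 2 μ := (ha.memLp n).toLp _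

/-- `s_a(t) = ∑_n a_n g(t - nT)`, the series being taken in mean square. -/
def modulated {a : ℤ → Ω → ℝ} (ha : IsBPSK μ a) (T : ℝ) (g : ℝ → ℂ) (t : ℝ) : Lp ℂ 2 μ :=
  ∑' n : ℤ, g (t - n * T) • symbol ha n

/-- The sampled signal `s(n) = s_a(n T_e)`. -/
def sampled {a : ℤ → Ω → ℝ} (ha : IsBPSK μ a) (T Te : ℝ) (g : ℝ → ℂ) (n : ℤ) : Lp ℂ 2 μ :=
  modulated ha T g (n * Te)

end Signals

end BPSK

end

noncomputable section

namespace BPSK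

/-! Write `invFT F` for the pulse with spectrum `F`. An FIR filter multiplies the spectrum of the
pulse by a trigonometric polynomial in `Te * ν`. Shannon's condition makes the band fit in one
period of these polynomials. Since `G` is almost everywhere nonzero on the band, `G` times such
polynomials is dense in the L² functions on the band (`IsSpectrum.exists_firTransfer_approx`). As
`‖f‖²` equals `T⁻¹ ∫ |G ν * f (Te * ν)|²`, the unit-norm filter outputs are exactly the pulse
signals whose pulse is band-limited with energy `T` (`IsBPSK.unitFiltered_pulseSignal`).

For a pulse `f`, independence of the symbols turns the statistics at time `t` into lattice sums over
the shifts `t - j * T`: of `f(· + m * Te) * conj f` and `f²` for the correlations, and of `-2 *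
|f|⁴` for the cumulant. Such a sum is `T`-periodic in `t`, and the bounded spectrum makes it a
trigonometric polynomial (`IsSpectrum.hasSum_lattice`), of degree at most 1 for the quadratic
products and at most 3 for the quartic one, because `2 * b * T ≤ 2`. At `t = n * Te` the harmonic
`m` oscillates at frequency `m * α`. The excluded sampling periods are those for which two of the
relevant harmonics could alias, so a time average picks out a single Fourier coefficient, that is,
an integral over the line. Hence `β'` becomes `Φ'` and the averaged cumulant becomes `Ψ`. Both
functionals are invariant under scaling, so the energy constraint can be dropped
(`image_bandLimited_eq`).

The rest concerns band-limited functions only. The pointwise bound `|f|² ≤ 3` at energy `T` gives `Ψ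
≥ -6`, so the infima are finite. Enlarging the band enlarges the set of competitors, which gives
monotonicity. At `γ = 0` the spectra of `f` and of a translate by `±1/T` overlap only at an
endpoint, so the correction terms of `Φ'` vanish and `Φ' = Ψ + 2`. The criterion then follows from
monotonicity. -/

/-! ### Parseval, sampling and Plancherel for bounded spectra -/

theorem hasSum_congr {ι E : Type*} [AddCommMonoid E] [TopologicalSpace E] {f g : ι → E} {x y : E}
    (h : HasSum f x) (hfg : ∀ i, f i = g i) (hxy : x = y) : HasSum g y := by
  rwa [← hxy, ← funext hfg]

/-- Parseval's identity on an interval, in polarised form. -/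
theorem hasSum_fourierCoeffOn_mul_conj {a b : ℝ} (hab : a < b) {f g : ℝ → ℂ}
    (hf : MemLp f 2 (volume.restrict (Ioc a b))) (hg : MemLp g 2 (volume.restrict (Ioc a b))) :
    HasSum (fun i => fourierCoeffOn hab f i * conj (fourierCoeffOn hab g i))
      ((b - a)⁻¹ • ∫ x in a..b, f x * conj (g x)) := by
  have := Fact.mk (by linarith : 0 < b - a)
  rw [← add_sub_cancel a b] at hf hg
  have h := hf.memLp_liftIoc.haarAddCircle
  have k := hg.memLp_liftIoc.haarAddCircle
  refine hasSum_congr ((fourierBasis (T := b - a)).hasSum_inner_mul_inner k.toLp h.toLp)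
    (fun i => ?_) ?_
  · have e1 := fourierBasis_repr h.toLp i
    have e2 := fourierBasis_repr k.toLp i
    rw [HilbertBasis.repr_apply_apply] at e1 e2
    rw [← inner_conj_symm k.toLp, e1, e2, fourierCoeff_congr_ae h.coeFn_toLp,
      fourierCoeff_congr_ae k.coeFn_toLp, fourierCoeff_liftIoc_eq, fourierCoeff_liftIoc_eq,
      mul_comm]
    simp
  · rw [L2.inner_def]
    have e : ∫ x in a..b, f x * conj (g x) = ∫ x in a..(a + (b - a)), f x * conj (g x) := by
      rw [add_sub_cancel]
    rw [e, ← AddCircle.integral_liftIoc_eq_intervalIntegral, ← AddCircle.integral_haarAddCircle]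
    apply integral_congr_ae
    filter_upwards [h.coeFn_toLp, k.coeFn_toLp] with x hx hy
    rw [RCLike.inner_apply, hx, hy]
    rfl

/-- The inverse Fourier transform of `F`. -/
def invFT (F : ℝ → ℂ) (t : ℝ) : ℂ :=
  ∫ ν : ℝ, Complex.exp (2 * Real.pi * Complex.I * ν * t) * F ν

/-- `F` is square integrable and vanishes outside `[-b, b]`. -/
structure IsSpectrum (b : ℝ) (F : ℝ → ℂ) : Prop where
  memLp : MemLp F 2 volume
  eq_zero : ∀ ν, ν ∉ Icc (-b) b → F ν = 0

theorem norm_exp_two_pi (x t : ℝ) : ‖Complex.exp (2 * Real.pi * Complex.I * x * t)‖ = 1 := by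
  rw [show (2 * Real.pi * Complex.I * x * t : ℂ) = ((2 * Real.pi * x * t : ℝ) : ℂ) * Complex.I by
    push_cast; ring]
  exact Complex.norm_exp_ofReal_mul_I _

theorem conj_exp_two_pi (x t : ℝ) : conj (Complex.exp (2 * Real.pi * Complex.I * x * t)) =
    Complex.exp (-(2 * Real.pi * Complex.I * x * t)) := by
  rw [← Complex.exp_conj]
  simp [Complex.conj_ofNat]

theorem memLp_exp_mul {F : ℝ → ℂ} {p : ENNReal} {μ : Measure ℝ} (hF : MemLp F p μ) (t : ℝ) :
    MemLp (fun ν : ℝ => Complex.exp (2 * Real.pi * Complex.I * ν * t) * F ν) p μ := by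
  refine hF.congr_norm ?_ ?_
  · exact (by fun_prop : Continuous fun ν : ℝ =>
      Complex.exp (2 * Real.pi * Complex.I * ν * t)).aestronglyMeasurable.mul hF.1
  · exact .of_forall fun ν => by rw [norm_mul, norm_exp_two_pi, one_mul]

theorem integral_eq_intervalIntegral_of_eq_zero {E : Type*} [NormedAddCommGroup E]
    [NormedSpace ℝ E] {F : ℝ → E} {a b : ℝ} (hab : a ≤ b) (h : ∀ ν, ν ∉ Icc a b → F ν = 0) :
    ∫ ν, F ν = ∫ ν in a..b, F ν := by
  rw [intervalIntegral.integral_of_le hab, ← integral_Icc_eq_integral_Ioc]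
  exact (setIntegral_eq_integral_of_forall_compl_eq_zero h).symm

/-- The sampling theorem, in polarised form, at the Nyquist rate `L`. -/
theorem hasSum_sampling {F H : ℝ → ℂ} {a L : ℝ} (hL : 0 < L) (hF : MemLp F 2 volume)
    (hH : MemLp H 2 volume) (hF0 : ∀ ν, ν ∉ Icc a (a + L) → F ν = 0)
    (hH0 : ∀ ν, ν ∉ Icc a (a + L) → H ν = 0) (t : ℝ) :
    HasSum (fun j : ℤ => invFT F (t - j / L) * conj (invFT H (t - j / L)))
      (L * ∫ ν, F ν * conj (H ν)) := by
  have hab : a < a + L := by linarith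
  -- The samples of the inverse transform are, up to the factor `L`, the Fourier coefficients on the
  -- window of the modulated spectrum; Parseval then does the rest.
  have key : ∀ {G : ℝ → ℂ}, (∀ ν, ν ∉ Icc a (a + L) → G ν = 0) → ∀ j : ℤ,
      fourierCoeffOn hab (fun ν : ℝ => Complex.exp (2 * Real.pi * Complex.I * ν * t) * G ν) j
        = (L : ℂ)⁻¹ * invFT G (t - j / L) := by
    intro G hG j
    rw [fourierCoeffOn_eq_integral, invFT, integral_eq_intervalIntegral_of_eq_zero hab.le
      (fun ν hν => by rw [hG ν hν, mul_zero])]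
    simp only [add_sub_cancel_left, fourier_coe_apply]
    rw [Complex.real_smul]
    congr 1
    · simp
    · refine intervalIntegral.integral_congr fun ν _ => ?_
      simp only [smul_eq_mul]
      rw [← mul_assoc, ← Complex.exp_add]
      congr 2
      push_cast
      field_simp
      ring
  have h := hasSum_fourierCoeffOn_mul_conj hab ((memLp_exp_mul hF t).restrict _)
    ((memLp_exp_mul hH t).restrict _)
  simp only [key hF0, key hH0, add_sub_cancel_left] at h
  have hL' : (L : ℂ) ≠ 0 := by exact_mod_cast hL.ne'
  refine hasSum_congr (h.mul_left ((L : ℂ) ^ 2)) (fun j => ?_) ?_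
  · simp only [map_mul, map_inv₀, Complex.conj_ofReal]
    field_simp
  · rw [integral_eq_intervalIntegral_of_eq_zero hab.le
      (fun ν hν => by rw [hF0 ν hν, zero_mul]), Complex.real_smul]
    push_cast
    rw [← mul_assoc, show (L : ℂ) ^ 2 * (L : ℂ)⁻¹ = L by field_simp]
    congr 1
    refine intervalIntegral.integral_congr fun ν _ => ?_
    simp only [map_mul, conj_exp_two_pi]
    have : Complex.exp (2 * Real.pi * Complex.I * ν * t) *
      Complex.exp (-(2 * Real.pi * Complex.I * ν * t)) = 1 := by
      rw [← Complex.exp_add, add_neg_cancel, Complex.exp_zero]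
    linear_combination (F ν * conj (H ν)) * this

theorem iUnion_preimage_Ioc {δ : ℝ} (hδ : 0 < δ) :
    ⋃ j : ℤ, (fun t : ℝ => t + j * δ) ⁻¹' Ioc 0 δ = univ := by
  refine eq_univ_of_forall fun t => ?_
  obtain ⟨j, hj, -⟩ := existsUnique_add_zsmul_mem_Ioc hδ t 0
  exact mem_iUnion.2 ⟨j, by rwa [zero_add, zsmul_eq_mul] at hj⟩

theorem pairwise_disjoint_preimage_Ioc {δ : ℝ} (hδ : 0 < δ) :
    Pairwise (Function.onFun Disjoint fun j : ℤ => (fun t : ℝ => t + j * δ) ⁻¹' Ioc 0 δ) := by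
  intro i j hij
  refine Set.disjoint_left.2 fun t hi hj => hij ?_
  refine (existsUnique_add_zsmul_mem_Ioc hδ t 0).unique ?_ ?_
  · rwa [zero_add, zsmul_eq_mul]
  · rwa [zero_add, zsmul_eq_mul]

/-- The translates of one cell by multiples of `δ` tile the line. -/
theorem lintegral_eq_tsum_Ioc {δ : ℝ} (hδ : 0 < δ) (φ : ℝ → ENNReal) :
    ∫⁻ t, φ t = ∑' j : ℤ, ∫⁻ t in Ioc 0 δ, φ (t - j * δ) := by
  rw [← setLIntegral_univ, ← iUnion_preimage_Ioc hδ, lintegral_iUnion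
    (fun j => (measurable_add_const _) measurableSet_Ioc) (pairwise_disjoint_preimage_Ioc hδ)]
  congr 1 with j
  rw [← (measurePreserving_add_right volume ((j : ℝ) * δ)).setLIntegral_comp_preimage_emb
    (measurableEmbedding_addRight _) (fun t => φ (t - j * δ))]
  simp only [add_sub_cancel_right]

theorem hasSum_integral_Ioc {E : Type*} [NormedAddCommGroup E] [NormedSpace ℝ E] {δ : ℝ}
    (hδ : 0 < δ) {φ : ℝ → E} (hφ : Integrable φ) :
    HasSum (fun j : ℤ => ∫ t in Ioc 0 δ, φ (t - j * δ)) (∫ t, φ t) := by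
  have h := hasSum_integral_iUnion
    (fun j : ℤ => (measurable_add_const ((j : ℝ) * δ)) (measurableSet_Ioc (a := (0 : ℝ)) (b := δ)))
    (pairwise_disjoint_preimage_Ioc hδ) hφ.integrableOn
  rw [iUnion_preimage_Ioc hδ, setIntegral_univ] at h
  refine hasSum_congr h (fun j => ?_) rfl
  rw [← (measurePreserving_add_right volume ((j : ℝ) * δ)).setIntegral_preimage_emb
    (measurableEmbedding_addRight _) (fun t => φ (t - j * δ))]
  simp only [add_sub_cancel_right]

/-- The integral of an integrable function is the integral over a period of its periodisation. -/
theorem integral_Ioc_tsum {δ : ℝ} (hδ : 0 < δ) {φ : ℝ → ℂ} (hφ : Integrable φ) :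
    ∫ t in Ioc 0 δ, ∑' j : ℤ, φ (t - j * δ) = ∫ t, φ t := by
  rw [integral_tsum, (hasSum_integral_Ioc hδ hφ).tsum_eq]
  · intro j
    exact (hφ.1.comp_measurePreserving (measurePreserving_sub_right volume _)).restrict
  · rw [← lintegral_eq_tsum_Ioc hδ fun t => ‖φ t‖ₑ]
    exact hφ.2.ne

theorem IsSpectrum.integrable {b : ℝ} {F : ℝ → ℂ} (hF : IsSpectrum b F) : Integrable F := by
  have : IntegrableOn F (Icc (-b) b) := (hF.memLp.restrict _).integrable (by norm_num)
  rwa [integrableOn_iff_integrable_of_support_subset] at this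
  intro ν hν
  by_contra h
  exact hν (hF.eq_zero ν h)

theorem integrable_exp_mul {F : ℝ → ℂ} {μ : Measure ℝ} (hF : Integrable F μ) (t : ℝ) :
    Integrable (fun ν : ℝ => Complex.exp (2 * Real.pi * Complex.I * ν * t) * F ν) μ :=
  memLp_one_iff_integrable.1 (memLp_exp_mul (memLp_one_iff_integrable.2 hF) t)

theorem IsSpectrum.continuous_invFT {b : ℝ} {F : ℝ → ℂ} (hF : IsSpectrum b F) :
    Continuous (invFT F) := by
  refine continuous_of_dominated (bound := fun ν => ‖F ν‖)
    (fun t => (integrable_exp_mul hF.integrable t).1) (fun t => .of_forall fun ν => ?_)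
    hF.integrable.norm (.of_forall fun ν => by fun_prop)
  rw [norm_mul, norm_exp_two_pi, one_mul]

/-- The sum does not depend on `t`, so integrating it over a single sampling cell gives the whole
energy. Membership in L² comes from this, and the polarised version gives Plancherel. -/
theorem IsSpectrum.hasSum_normSq {b : ℝ} (hb : 0 < b) {F : ℝ → ℂ} (hF : IsSpectrum b F) (t : ℝ) :
    HasSum (fun j : ℤ => ‖invFT F (t - j / (2 * b))‖ ^ 2) (2 * b * ∫ ν, ‖F ν‖ ^ 2) := by
  have h0 : ∀ ν, ν ∉ Icc (-b) (-b + 2 * b) → F ν = 0 := by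
    rw [show -b + 2 * b = b by ring]; exact hF.eq_zero
  have h := hasSum_sampling (by positivity : 0 < 2 * b) hF.memLp hF.memLp h0 h0 t
  simp only [Complex.mul_conj'] at h
  have e : ∫ ν, (‖F ν‖ : ℂ) ^ 2 = ((∫ ν, ‖F ν‖ ^ 2 : ℝ) : ℂ) := by
    rw [← integral_complex_ofReal]; simp
  rw [e] at h
  rw [← Complex.hasSum_ofReal]
  push_cast at h ⊢
  exact h

theorem IsSpectrum.memLp_invFT {b : ℝ} (hb : 0 < b) {F : ℝ → ℂ} (hF : IsSpectrum b F) :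
    MemLp (invFT F) 2 volume := by
  refine (memLp_two_iff_integrable_sq_norm hF.continuous_invFT.aestronglyMeasurable).2
    ⟨(hF.continuous_invFT.norm.pow 2).aestronglyMeasurable, ?_⟩
  have hδ : 0 < 1 / (2 * b) := by positivity
  rw [HasFiniteIntegral, lintegral_eq_tsum_Ioc hδ, ← lintegral_tsum]
  · have : ∀ t, ∑' j : ℤ, ‖‖invFT F (t - j * (1 / (2 * b)))‖ ^ 2‖ₑ
        = ENNReal.ofReal (2 * b * ∫ ν, ‖F ν‖ ^ 2) := by
      intro t
      rw [← (hF.hasSum_normSq hb t).tsum_eq, ENNReal.ofReal_tsum_of_nonneg (fun _ => by positivity)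
        (hF.hasSum_normSq hb t).summable]
      congr 1 with j
      rw [Real.enorm_eq_ofReal (by positivity), mul_one_div]
    simp only [this]
    simp [ENNReal.mul_lt_top_iff]
  · intro j
    have := hF.continuous_invFT
    exact (by fun_prop : Continuous fun t => ‖‖invFT F (t - j * (1 / (2 * b)))‖ ^ 2‖ₑ).aemeasurable

theorem integrable_mul_conj {α : Type*} [MeasurableSpace α] {μ : Measure α} {f h : α → ℂ}
    (hf : MemLp f 2 μ) (hh : MemLp h 2 μ) : Integrable (fun t => f t * conj (h t)) μ :=
  hf.integrable_mul (q := 2) (g := fun t => conj (h t)) hh.star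

/-- Plancherel's identity for functions with a bounded spectrum. -/
theorem IsSpectrum.plancherel {b : ℝ} (hb : 0 < b) {F H : ℝ → ℂ} (hF : IsSpectrum b F)
    (hH : IsSpectrum b H) :
    ∫ t, invFT F t * conj (invFT H t) = ∫ ν, F ν * conj (H ν) := by
  have hδ : 0 < 1 / (2 * b) := by positivity
  have e : -b + 2 * b = b := by ring
  rw [← integral_Ioc_tsum hδ (integrable_mul_conj (hF.memLp_invFT hb) (hH.memLp_invFT hb))]
  have : ∀ t, ∑' j : ℤ, invFT F (t - j * (1 / (2 * b))) * conj (invFT H (t - j * (1 / (2 * b))))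
      = (2 * b : ℝ) * ∫ ν, F ν * conj (H ν) := by
    intro t
    rw [← (hasSum_sampling (by positivity : 0 < 2 * b) hF.memLp hH.memLp
      (by rw [e]; exact hF.eq_zero) (by rw [e]; exact hH.eq_zero) t).tsum_eq]
    simp only [mul_one_div]
  simp only [this]
  rw [setIntegral_const]
  have hb' : (b : ℂ) ≠ 0 := by exact_mod_cast hb.ne'
  rw [Complex.real_smul]
  simp only [Real.volume_real_Ioc_of_le hδ.le]
  push_cast
  field_simp
  simp

/-! ### Lattice sums of band-limited products -/

theorem sum_Icc_zpow {w : ℂ} (hw : w ≠ 0) (N : ℕ) :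
    ∑ n ∈ Finset.Icc (-(N : ℤ)) (N : ℤ), w ^ n =
      w ^ (-(N : ℤ)) * ∑ i ∈ Finset.range (2 * N + 1), w ^ i := by
  rw [Finset.mul_sum]
  refine Finset.sum_nbij' (fun n => (n + N).toNat) (fun i => (i : ℤ) - N) ?_ ?_ ?_ ?_ ?_
  · intro n hn; simp only [Finset.mem_Icc, Finset.mem_range] at *; omega
  · intro n hn; simp only [Finset.mem_Icc, Finset.mem_range] at *; omega
  · intro n hn; simp only [Finset.mem_Icc] at *; omega
  · intro n hn; simp only [Finset.mem_range] at *; omega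
  · intro n hn
    simp only [Finset.mem_Icc] at hn
    rw [← zpow_natCast, ← zpow_add₀ hw]
    congr 1
    omega

/-- Orthogonality of the characters of the integers modulo `2 * K + 1`. It serves to extract the
lattice of step `T` from one that is `2 * K + 1` times finer. -/
theorem sum_Icc_exp_eq_ite (K : ℕ) (j : ℤ) :
    ∑ m ∈ Finset.Icc (-(K : ℤ)) (K : ℤ),
        Complex.exp (2 * Real.pi * Complex.I * m * (j / (2 * K + 1 : ℝ))) =
      if ((2 * K + 1 : ℤ)) ∣ j then (2 * K + 1 : ℂ) else 0 := by
  set w := Complex.exp (2 * Real.pi * Complex.I * (j / (2 * K + 1 : ℝ))) with hw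
  have hK : (2 * K + 1 : ℂ) ≠ 0 := by exact_mod_cast (by omega : 2 * K + 1 ≠ 0)
  have h1 : ∀ m : ℤ, Complex.exp (2 * Real.pi * Complex.I * m * (j / (2 * K + 1 : ℝ))) = w ^ m := by
    intro m
    rw [hw, ← Complex.exp_int_mul]
    congr 1; ring
  have hwK : w ^ (2 * K + 1) = 1 := by
    rw [hw, ← Complex.exp_nat_mul, Complex.exp_eq_one_iff]
    refine ⟨j, ?_⟩
    push_cast
    field_simp
  simp only [h1]
  rw [sum_Icc_zpow (hw ▸ Complex.exp_ne_zero _ : w ≠ 0)]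
  split_ifs with h
  · obtain ⟨i, rfl⟩ := h
    have : w = 1 := by
      rw [hw, Complex.exp_eq_one_iff]
      refine ⟨i, ?_⟩
      push_cast
      field_simp
    simp [this]
  · have : w ≠ 1 := by
      intro h1
      rw [hw, Complex.exp_eq_one_iff] at h1
      obtain ⟨i, hi⟩ := h1
      refine h ⟨i, ?_⟩
      have h2 : (2 * Real.pi * Complex.I : ℂ) ≠ 0 := Complex.two_pi_I_ne_zero
      rw [mul_comm (i : ℂ)] at hi
      have h3 := mul_left_cancel₀ h2 hi
      push_cast at h3
      rw [div_eq_iff hK] at h3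
      have : (j : ℂ) = ((i * (2 * K + 1) : ℤ) : ℂ) := by push_cast; exact h3
      rw [mul_comm]
      exact_mod_cast this
    rw [geom_sum_eq this, hwK]
    simp

theorem invFT_shift (H : ℝ → ℂ) (c t : ℝ) :
    invFT (fun ν => H (ν - c)) t = Complex.exp (2 * Real.pi * Complex.I * c * t) * invFT H t := by
  rw [invFT, invFT, ← integral_const_mul,
    ← integral_sub_right_eq_self (μ := volume)
      (fun ν : ℝ => Complex.exp (2 * Real.pi * Complex.I * c * t) *
        (Complex.exp (2 * Real.pi * Complex.I * ν * t) * H ν)) c]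
  congr 1 with ν
  rw [← mul_assoc, ← Complex.exp_add]
  congr 2
  push_cast
  ring

theorem invFT_exp_mul (F : ℝ → ℂ) (τ t : ℝ) :
    invFT (fun ν => Complex.exp (2 * Real.pi * Complex.I * ν * τ) * F ν) t = invFT F (t + τ) := by
  rw [invFT, invFT]
  congr 1 with ν
  rw [← mul_assoc, ← Complex.exp_add]
  congr 2
  push_cast
  ring

/-- Lets a non-conjugate product such as `f²` be read as `f` times the conjugate of a band-limited
function, so that the polarised identities cover it. -/
theorem invFT_conj_neg (F : ℝ → ℂ) (t : ℝ) :
    invFT (fun ν => conj (F (-ν))) t = conj (invFT F t) := by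
  rw [invFT, invFT, ← integral_conj, ← integral_neg_eq_self]
  congr 1 with ν
  rw [map_mul, conj_exp_two_pi, neg_neg]
  congr 2
  push_cast
  ring

theorem IsSpectrum.conj_neg {b : ℝ} {F : ℝ → ℂ} (hF : IsSpectrum b F) :
    IsSpectrum b fun ν => conj (F (-ν)) where
  memLp := (hF.memLp.comp_measurePreserving (Measure.measurePreserving_neg volume)).star
  eq_zero ν hν := by
    rw [hF.eq_zero, map_zero]
    intro h
    exact hν ⟨by linarith [h.2], by linarith [h.1]⟩

theorem IsSpectrum.exp_mul {b : ℝ} {F : ℝ → ℂ} (hF : IsSpectrum b F) (τ : ℝ) :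
    IsSpectrum b fun ν => Complex.exp (2 * Real.pi * Complex.I * ν * τ) * F ν where
  memLp := memLp_exp_mul hF.memLp τ
  eq_zero ν hν := by rw [hF.eq_zero ν hν, mul_zero]

theorem IsSpectrum.mono {b b' : ℝ} (h : b ≤ b') {F : ℝ → ℂ} (hF : IsSpectrum b F) :
    IsSpectrum b' F where
  memLp := hF.memLp
  eq_zero ν hν := hF.eq_zero ν fun h' => hν ⟨by linarith [h'.1], by linarith [h'.2]⟩

theorem IsSpectrum.shift {b : ℝ} {F : ℝ → ℂ} (hF : IsSpectrum b F) (c : ℝ) :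
    IsSpectrum (b + |c|) fun ν => F (ν - c) where
  memLp := hF.memLp.comp_measurePreserving (measurePreserving_sub_right volume c)
  eq_zero ν hν := by
    refine hF.eq_zero _ fun h => hν ?_
    have := abs_le.1 (le_refl |c|)
    exact ⟨by linarith [h.1], by linarith [h.2]⟩

/-- The `m`-th Fourier coefficient of the `T`-periodisation of `φ`. -/
def latticeCoeff (T : ℝ) (φ : ℝ → ℂ) (m : ℤ) : ℂ :=
  (T : ℂ)⁻¹ * ∫ u : ℝ, φ u * Complex.exp (-(2 * Real.pi * Complex.I * m * (u / T)))

/-- The `T`-periodisation of a product of two band-limited functions is a trigonometric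
polynomial. -/
theorem IsSpectrum.hasSum_lattice {b T : ℝ} (hb : 0 < b) (hT : 0 < T) {K : ℕ}
    (hbK : 2 * b * T ≤ K + 1) {F H : ℝ → ℂ} (hF : IsSpectrum b F) (hH : IsSpectrum b H) (t : ℝ) :
    HasSum (fun j : ℤ => invFT F (t - j * T) * conj (invFT H (t - j * T)))
      (∑ m ∈ Finset.Icc (-(K : ℤ)) (K : ℤ),
        latticeCoeff T (fun u => invFT F u * conj (invFT H u)) m *
          Complex.exp (2 * Real.pi * Complex.I * m * (t / T))) := by
  have hT' : (T : ℂ) ≠ 0 := by exact_mod_cast hT.ne'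
  have hK : (0 : ℝ) < 2 * K + 1 := by positivity
  have hK' : (2 * K + 1 : ℂ) ≠ 0 := by exact_mod_cast hK.ne'
  have hL : 0 < (2 * K + 1) / T := by positivity
  -- Sample on the finer lattice of step `T / (2K+1)`, with `H` shifted by `m / T`. Both spectra fit
  -- in a window of length `(2K+1) / T` because `|m| ≤ K` and `2 * b ≤ (K+1) / T`. The right-hand
  -- side is the `m`-th lattice coefficient, by Plancherel.
  have one : ∀ m ∈ Finset.Icc (-(K : ℤ)) (K : ℤ),
      HasSum (fun j : ℤ => invFT F (t - j * T / (2 * K + 1)) *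
          conj (invFT H (t - j * T / (2 * K + 1))) *
          Complex.exp (2 * Real.pi * Complex.I * m * (j / (2 * K + 1 : ℝ))))
        ((2 * K + 1) * (latticeCoeff T (fun u => invFT F u * conj (invFT H u)) m *
          Complex.exp (2 * Real.pi * Complex.I * m * (t / T)))) := by
    intro m hm
    obtain ⟨hm1, hm2⟩ := Finset.mem_Icc.1 hm
    have hm1 : -(K : ℝ) ≤ m := by exact_mod_cast hm1
    have hm2 : (m : ℝ) ≤ K := by exact_mod_cast hm2
    have hHm := hH.shift (m / T)
    have hb1 : 2 * b ≤ (K + 1) / T := by rw [le_div_iff₀ hT]; exact hbK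
    have hq1 : -((K : ℝ) / T) ≤ m / T := by rw [← neg_div]; gcongr
    have hq2 : (m : ℝ) / T ≤ K / T := by gcongr
    -- The window is centred at `m / (2T)`, midway between the centres of the two spectra.
    have ea : (m - (2 * K + 1 : ℝ)) / (2 * T) = (m / T - K / T - (K + 1) / T) / 2 := by
      field_simp; ring
    have eL : (2 * K + 1 : ℝ) / T = K / T + (K + 1) / T := by field_simp; ring
    have h := hasSum_sampling (a := (m - (2 * K + 1 : ℝ)) / (2 * T)) hL hF.memLp hHm.memLp
      (by
        intro ν hν
        refine hF.eq_zero ν fun h => hν ⟨?_, ?_⟩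
        · rw [ea]; linarith [h.1]
        · rw [ea, eL]; linarith [h.2])
      (by
        intro ν hν
        refine hH.eq_zero _ fun h => hν ⟨?_, ?_⟩
        · rw [ea]; linarith [h.1]
        · rw [ea, eL]; linarith [h.2]) t
    rw [← (hF.mono (le_add_of_nonneg_right (abs_nonneg ((m : ℝ) / T)))).plancherel
      (by positivity) hHm] at h
    refine hasSum_congr (h.mul_right (Complex.exp (2 * Real.pi * Complex.I * m * (t / T))))
      (fun j => ?_) ?_
    · rw [invFT_shift, map_mul, conj_exp_two_pi]
      rw [show (j : ℝ) / ((2 * K + 1) / T) = j * T / (2 * K + 1) by field_simp]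
      have e : Complex.exp (-(2 * Real.pi * Complex.I * ((m / T : ℝ) : ℂ) *
            ((t - j * T / (2 * K + 1) : ℝ) : ℂ))) * Complex.exp (2 * Real.pi * Complex.I * m * (t / T))
          = Complex.exp (2 * Real.pi * Complex.I * m * (j / (2 * K + 1 : ℝ))) := by
        rw [← Complex.exp_add]
        congr 1
        push_cast
        field_simp
        ring
      rw [← e]
      ring
    · rw [latticeCoeff, ← mul_assoc, ← mul_assoc]
      congr 2
      · push_cast; field_simp
      · congr 1 with u
        rw [invFT_shift, map_mul, conj_exp_two_pi]
        rw [mul_comm (Complex.exp _), ← mul_assoc]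
        congr 3
        push_cast
        field_simp
  -- Summing over `m` kills every fine sample except those whose index is a multiple of `2 * K + 1`,
  -- which form the original lattice.
  have h := (hasSum_sum one).mul_left ((2 * K + 1 : ℂ)⁻¹)
  simp only [← Finset.mul_sum, sum_Icc_exp_eq_ite] at h
  rw [inv_mul_cancel_left₀ hK'] at h
  have inj : Function.Injective fun j : ℤ => (2 * (K : ℤ) + 1) * j :=
    fun i j hij => mul_left_cancel₀ (by omega) hij
  rw [← inj.hasSum_iff] at h
  · refine hasSum_congr h (fun j => ?_) rfl
    simp only [Function.comp_apply, dvd_mul_right, if_true]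
    have : ((((2 * (K : ℤ) + 1) * j : ℤ) : ℝ)) * T / (2 * K + 1) = j * T := by
      push_cast; field_simp
    rw [this]
    field_simp
  · intro j hj
    rw [if_neg, mul_zero, mul_zero]
    rintro ⟨i, hi⟩
    exact hj ⟨i, hi.symm⟩

/-! ### Products of band-limited functions -/

open scoped Convolution FourierTransform

theorem invFT_eq_fourier (F : ℝ → ℂ) (t : ℝ) : invFT F t = 𝓕 F (-t) := by
  rw [Real.fourier_eq', invFT]
  congr 1 with ν
  rw [smul_eq_mul]
  congr 2
  simp
  ring

/-- The supports add, and the convolution is bounded since `xy ≤ x² + y²` under the integral; a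
bounded function on a bounded interval is in L². -/
theorem IsSpectrum.convolution {b : ℝ} {F H : ℝ → ℂ} (hF : IsSpectrum b F) (hH : IsSpectrum b H) :
    IsSpectrum (2 * b) (F ⋆[ContinuousLinearMap.mul ℂ ℂ, volume] H) := by
  have h0 : ∀ u, u ∉ Icc (-(2 * b)) (2 * b) →
      (F ⋆[ContinuousLinearMap.mul ℂ ℂ, volume] H) u = 0 := by
    intro u hu
    refine integral_eq_zero_of_ae (.of_forall fun ν => ?_)
    simp only [ContinuousLinearMap.mul_apply', Pi.zero_apply, mul_eq_zero]
    by_contra! h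
    have h1 : ν ∈ Icc (-b) b := by by_contra h'; exact h.1 (hF.eq_zero _ h')
    have h2 : u - ν ∈ Icc (-b) b := by by_contra h'; exact h.2 (hH.eq_zero _ h')
    exact hu ⟨by linarith [h1.1, h2.1], by linarith [h1.2, h2.2]⟩
  refine ⟨?_, h0⟩
  have hm : AEStronglyMeasurable (F ⋆[ContinuousLinearMap.mul ℂ ℂ, volume] H) volume :=
    (hF.integrable.integrable_convolution _ hH.integrable).1
  have hb : ∀ u, ‖(F ⋆[ContinuousLinearMap.mul ℂ ℂ, volume] H) u‖ ≤
      (∫ ν, ‖F ν‖ ^ 2) + ∫ ν, ‖H ν‖ ^ 2 := by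
    intro u
    have iF := hF.memLp.integrable_norm_pow (by norm_num)
    have iH := hH.memLp.integrable_norm_pow (by norm_num)
    rw [← integral_sub_left_eq_self (fun ν => ‖H ν‖ ^ 2) volume u, ← integral_add iF
      (by simpa using iH.comp_sub_left u)]
    refine norm_integral_le_of_norm_le (iF.add (by simpa using iH.comp_sub_left u))
      (.of_forall fun ν => ?_)
    simp only [ContinuousLinearMap.mul_apply', norm_mul]
    nlinarith [sq_nonneg (‖F ν‖ - ‖H (u - ν)‖), sq_nonneg (‖F ν‖), sq_nonneg (‖H (u - ν)‖)]
  have h2 := MemLp.of_bound (p := 2) (hm.restrict (s := Icc (-(2 * b)) (2 * b))) _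
    (.of_forall hb)
  rw [← memLp_indicator_iff_restrict measurableSet_Icc] at h2
  rwa [indicator_eq_self.2 fun u hu => ?_] at h2
  by_contra h
  exact hu (h0 u h)

/-- Makes `f²` band-limited, so that `|f|⁴ = f² * conj (f²)` falls under the lattice formula for
quadratic products. -/
theorem IsSpectrum.invFT_convolution {b : ℝ} {F H : ℝ → ℂ} (hF : IsSpectrum b F)
    (hH : IsSpectrum b H) (t : ℝ) :
    invFT (F ⋆[ContinuousLinearMap.mul ℂ ℂ, volume] H) t = invFT F t * invFT H t := by
  simp only [invFT_eq_fourier]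
  exact Real.fourier_mul_convolution_eq hF.integrable hH.integrable _

/-! ### Moments of finite combinations of symbols -/

/-- The finite linear combination `∑_{j ∈ s} c_j a_j` of symbols. -/
def symbolSum {Ω : Type*} (a : ℤ → Ω → ℝ) (c : ℤ → ℂ) (s : Finset ℤ) (ω : Ω) : ℂ :=
  ∑ j ∈ s, c j * (a j ω : ℂ)

theorem symbolSum_insert {Ω : Type*} {a : ℤ → Ω → ℝ} (c : ℤ → ℂ) {s : Finset ℤ} {i : ℤ} (hi : i ∉ s) (ω : Ω) :
    symbolSum a c (insert i s) ω = symbolSum a c s ω + c i * (a i ω : ℂ) := by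
  rw [symbolSum, Finset.sum_insert hi, add_comm]; rfl

section Symbols

variable {Ω : Type*} [MeasurableSpace Ω] {μ : Measure Ω} {a : ℤ → Ω → ℝ}

theorem IsBPSK.measurable_symbolSum (ha : IsBPSK μ a) (c : ℤ → ℂ) (s : Finset ℤ) :
    Measurable (symbolSum a c s) := by
  have := ha.measurable
  unfold symbolSum
  fun_prop

theorem IsBPSK.ae_norm_symbolSum_le (ha : IsBPSK μ a) (c : ℤ → ℂ) (s : Finset ℤ) :
    ∀ᵐ ω ∂μ, ‖symbolSum a c s ω‖ ≤ ∑ j ∈ s, ‖c j‖ := by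
  filter_upwards [ae_all_iff.2 ha.values] with ω h
  refine (norm_sum_le _ _).trans (Finset.sum_le_sum fun j _ => ?_)
  rcases h j with h | h <;> simp [h]

/-- A new symbol is independent of the earlier ones and centred. In the inductions below this
removes every term that is odd in the added symbol, its even powers being 1. -/
theorem IsBPSK.integral_mul_symbol_eq_zero (ha : IsBPSK μ a) (c : ℤ → ℂ) {s : Finset ℤ} {i : ℤ}
    (hi : i ∉ s) {φ : ℂ → ℂ} (hφ : Continuous φ) :
    ∫ ω, φ (symbolSum a c s ω) * (a i ω : ℂ) ∂μ = 0 := by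
  have h := ha.indep.indepFun_finset s {i} (Finset.disjoint_singleton_right.2 hi) ha.measurable
  have h' := h.comp (φ := fun x : s → ℝ => φ (∑ j : s, c j * (x j : ℂ)))
    (ψ := fun x : ({i} : Finset ℤ) → ℝ => (x ⟨i, Finset.mem_singleton_self i⟩ : ℂ))
    (hφ.measurable.comp (by fun_prop)) (by fun_prop)
  have e : ∀ ω, ((fun x : s → ℝ => φ (∑ j : s, c j * (x j : ℂ))) ∘
      fun ω (j : s) => a j ω) ω = φ (symbolSum a c s ω) := by
    intro ω
    simp only [Function.comp_apply, symbolSum]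
    rw [Finset.sum_coe_sort s fun j => c j * (a j ω : ℂ)]
  have h2 := h'.integral_fun_mul_eq_mul_integral ?_ ?_
  · simp only [e] at h2
    simp only [Function.comp_apply] at h2
    rw [h2]
    have : ∫ ω, (a i ω : ℂ) ∂μ = 0 := by rw [integral_complex_ofReal, ha.mean i]; simp
    rw [this, mul_zero]
  · rw [show ((fun x : s → ℝ => φ (∑ j : s, c j * (x j : ℂ))) ∘
      fun ω (j : s) => a j ω) = _ from funext e]
    exact (hφ.measurable.comp (ha.measurable_symbolSum c s)).aestronglyMeasurable
  · exact (Complex.measurable_ofReal.comp (ha.measurable i)).aestronglyMeasurable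

theorem IsBPSK.integrable_mul_symbol (ha : IsBPSK μ a) (i : ℤ) {X : Ω → ℂ} (hX : Integrable X μ) :
    Integrable (fun ω => X ω * (a i ω : ℂ)) μ := by
  refine hX.mul_bdd (c := 1)
    (Complex.measurable_ofReal.comp (ha.measurable i)).aestronglyMeasurable ?_
  filter_upwards [ha.values i] with ω h
  rcases h with h | h <;> simp [h]

theorem IsBPSK.integrable_mul_symbol_real (ha : IsBPSK μ a) (i : ℤ) {X : Ω → ℝ}
    (hX : Integrable X μ) : Integrable (fun ω => X ω * a i ω) μ := by
  refine hX.mul_bdd (c := 1) (ha.measurable i).aestronglyMeasurable ?_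
  filter_upwards [ha.values i] with ω h
  rcases h with h | h <;> simp [h]

theorem IsBPSK.integral_ofReal_mul_symbol_eq_zero (ha : IsBPSK μ a) (c : ℤ → ℂ) {s : Finset ℤ}
    {i : ℤ} (hi : i ∉ s) {φ : ℂ → ℝ} (hφ : Continuous φ) :
    ∫ ω, φ (symbolSum a c s ω) * a i ω ∂μ = 0 := by
  have h := ha.integral_mul_symbol_eq_zero c hi (Complex.continuous_ofReal.comp hφ)
  simp only [Function.comp_apply, ← Complex.ofReal_mul] at h
  rw [integral_complex_ofReal] at h
  exact_mod_cast h

variable [IsProbabilityMeasure μ]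

theorem IsBPSK.integrable_comp_symbolSum (ha : IsBPSK μ a) (c : ℤ → ℂ) (s : Finset ℤ)
    {E : Type*} [NormedAddCommGroup E] {φ : ℂ → E} (hφ : Continuous φ) :
    Integrable (fun ω => φ (symbolSum a c s ω)) μ := by
  obtain ⟨C, hC⟩ := (isCompact_closedBall (0 : ℂ) (∑ j ∈ s, ‖c j‖)).exists_bound_of_continuousOn
    hφ.continuousOn
  refine Integrable.of_bound
    (hφ.comp_aestronglyMeasurable (ha.measurable_symbolSum c s).aestronglyMeasurable) C ?_
  filter_upwards [ha.ae_norm_symbolSum_le c s] with ω h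
  exact hC _ (by simpa using h)

theorem IsBPSK.integral_sq_symbolSum (ha : IsBPSK μ a) (c : ℤ → ℂ) (s : Finset ℤ) :
    ∫ ω, symbolSum a c s ω ^ 2 ∂μ = ∑ j ∈ s, c j ^ 2 := by
  induction s using Finset.induction_on with
  | empty => simp [symbolSum]
  | insert i s hi ih =>
    have h1 := ha.integrable_comp_symbolSum c s (φ := fun z => z ^ 2) (by fun_prop)
    have h2 := ha.integrable_mul_symbol i
      (ha.integrable_comp_symbolSum c s (φ := fun z => 2 * c i * z) (by fun_prop))
    have e : ∀ᵐ ω ∂μ, symbolSum a c (insert i s) ω ^ 2 =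
        (symbolSum a c s ω ^ 2 + 2 * c i * symbolSum a c s ω * (a i ω : ℂ)) + c i ^ 2 := by
      filter_upwards [ha.values i] with ω h
      rw [symbolSum_insert c hi]
      rcases h with h | h <;> rw [h] <;> push_cast <;> ring
    rw [integral_congr_ae e, integral_add (h1.fun_add h2) (integrable_const _), integral_add h1 h2, ih,
      ha.integral_mul_symbol_eq_zero c hi (φ := fun z => 2 * c i * z) (by fun_prop),
      Finset.sum_insert hi]
    simp; ring

theorem IsBPSK.integral_normSq_symbolSum (ha : IsBPSK μ a) (c : ℤ → ℂ) (s : Finset ℤ) :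
    ∫ ω, ‖symbolSum a c s ω‖ ^ 2 ∂μ = ∑ j ∈ s, ‖c j‖ ^ 2 := by
  induction s using Finset.induction_on with
  | empty => simp [symbolSum]
  | insert i s hi ih =>
    have h1 := ha.integrable_comp_symbolSum c s (φ := fun z => ‖z‖ ^ 2) (by fun_prop)
    have h2 := ha.integrable_mul_symbol_real i
      (ha.integrable_comp_symbolSum c s (φ := fun z => 2 * (z * conj (c i)).re) (by fun_prop))
    have e : ∀ᵐ ω ∂μ, ‖symbolSum a c (insert i s) ω‖ ^ 2 =
        (‖symbolSum a c s ω‖ ^ 2 + 2 * (symbolSum a c s ω * conj (c i)).re * a i ω)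
          + ‖c i‖ ^ 2 := by
      filter_upwards [ha.values i] with ω h
      rw [symbolSum_insert c hi]
      simp only [← Complex.normSq_eq_norm_sq, Complex.normSq_apply]
      rcases h with h | h <;> rw [h] <;> simp <;> ring
    rw [integral_congr_ae e, integral_add (h1.fun_add h2) (integrable_const _), integral_add h1 h2, ih,
      ha.integral_ofReal_mul_symbol_eq_zero c hi (φ := fun z => 2 * (z * conj (c i)).re)
        (by fun_prop), Finset.sum_insert hi]
    simp; ring

/-- The first two terms on the right are what Gaussian variables would give; the last is the
contribution of the kurtosis `-2`. -/
theorem IsBPSK.integral_norm_pow_four_symbolSum (ha : IsBPSK μ a) (c : ℤ → ℂ) (s : Finset ℤ) :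
    ∫ ω, ‖symbolSum a c s ω‖ ^ 4 ∂μ =
      2 * (∑ j ∈ s, ‖c j‖ ^ 2) ^ 2 + ‖∑ j ∈ s, c j ^ 2‖ ^ 2 - 2 * ∑ j ∈ s, ‖c j‖ ^ 4 := by
  induction s using Finset.induction_on with
  | empty => simp [symbolSum]
  | insert i s hi ih =>
    have h1 := ha.integrable_comp_symbolSum c s (φ := fun z => ‖z‖ ^ 4) (by fun_prop)
    have h2 := ha.integrable_comp_symbolSum c s (φ := fun z => 4 * ‖c i‖ ^ 2 * ‖z‖ ^ 2)
      (by fun_prop)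
    have h3' := ha.integrable_comp_symbolSum c s (φ := fun z => z ^ 2 * (2 * conj (c i) ^ 2))
      (by fun_prop)
    have h3 := ha.integrable_comp_symbolSum c s (φ := fun z => (z ^ 2 * (2 * conj (c i) ^ 2)).re)
      (by fun_prop)
    have h4 := ha.integrable_mul_symbol_real i (ha.integrable_comp_symbolSum c s
      (φ := fun z => 4 * (‖z‖ ^ 2 + ‖c i‖ ^ 2) * (z * conj (c i)).re) (by fun_prop))
    have e : ∀ᵐ ω ∂μ, ‖symbolSum a c (insert i s) ω‖ ^ 4 =
        (‖symbolSum a c s ω‖ ^ 4 + 4 * ‖c i‖ ^ 2 * ‖symbolSum a c s ω‖ ^ 2 +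
          (symbolSum a c s ω ^ 2 * (2 * conj (c i) ^ 2)).re +
          4 * (‖symbolSum a c s ω‖ ^ 2 + ‖c i‖ ^ 2) * (symbolSum a c s ω * conj (c i)).re * a i ω)
          + ‖c i‖ ^ 4 := by
      filter_upwards [ha.values i] with ω h
      rw [symbolSum_insert c hi]
      have e4 : ∀ z : ℂ, ‖z‖ ^ 4 = (‖z‖ ^ 2) ^ 2 := fun z => by ring
      simp only [e4, ← Complex.normSq_eq_norm_sq, Complex.normSq_apply]
      rcases h with h | h <;> rw [h] <;> simp [pow_two] <;> ring
    rw [integral_congr_ae e, integral_add (((h1.fun_add h2).fun_add h3).fun_add h4) (integrable_const _),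
      integral_add ((h1.fun_add h2).fun_add h3) h4, integral_add (h1.fun_add h2) h3, integral_add h1 h2, ih,
      ha.integral_ofReal_mul_symbol_eq_zero c hi
        (φ := fun z => 4 * (‖z‖ ^ 2 + ‖c i‖ ^ 2) * (z * conj (c i)).re) (by fun_prop),
      integral_const_mul, ha.integral_normSq_symbolSum, Finset.sum_insert hi, Finset.sum_insert hi,
      Finset.sum_insert hi]
    have e3 : ∫ ω, (symbolSum a c s ω ^ 2 * (2 * conj (c i) ^ 2)).re ∂μ =
        ((∑ j ∈ s, c j ^ 2) * (2 * conj (c i) ^ 2)).re := by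
      rw [← ha.integral_sq_symbolSum, ← integral_mul_const]
      exact integral_re h3'
    rw [e3]
    generalize ∑ j ∈ s, c j ^ 2 = Q
    have e4 : ∀ z : ℂ, ‖z‖ ^ 4 = (‖z‖ ^ 2) ^ 2 := fun z => by ring
    simp only [e4, ← Complex.normSq_eq_norm_sq, Complex.normSq_apply]
    simp [pow_two]
    ring

theorem norm_sum_sq_le {ι : Type*} (c : ι → ℂ) (s : Finset ι) :
    ‖∑ j ∈ s, c j ^ 2‖ ≤ ∑ j ∈ s, ‖c j‖ ^ 2 :=
  (norm_sum_le _ _).trans (by simp)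

/-- Controls L⁴ norms by L² norms, whence series of symbols that converge in mean square also
converge in L⁴. -/
theorem IsBPSK.integral_norm_pow_four_symbolSum_le (ha : IsBPSK μ a) (c : ℤ → ℂ) (s : Finset ℤ) :
    ∫ ω, ‖symbolSum a c s ω‖ ^ 4 ∂μ ≤ 3 * (∑ j ∈ s, ‖c j‖ ^ 2) ^ 2 := by
  rw [ha.integral_norm_pow_four_symbolSum]
  have h1 := pow_le_pow_left₀ (norm_nonneg _) (norm_sum_sq_le c s) 2
  have h2 : 0 ≤ ∑ j ∈ s, ‖c j‖ ^ 4 := Finset.sum_nonneg fun _ _ => by positivity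
  linarith

end Symbols

/-! ### Infinite series of symbols and their cumulants -/

section SymbolSeries

variable {Ω : Type*} [MeasurableSpace Ω] {μ : Measure Ω} {a : ℤ → Ω → ℝ}

theorem integral_mul_conj_eq_inner (x y : Lp ℂ 2 μ) :
    ∫ ω, x ω * conj (y ω) ∂μ = inner ℂ y x := by
  rw [L2.inner_def]
  simp only [RCLike.inner_apply]

theorem Lp_four_norm_pow (x : Lp ℂ 4 μ) : ‖x‖ ^ 4 = ∫ ω, ‖x ω‖ ^ 4 ∂μ := by
  rw [Lp.norm_def, (Lp.memLp x).eLpNorm_eq_integral_rpow_norm (by norm_num) (by norm_num),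
    ENNReal.toReal_ofReal (by positivity)]
  have h4 : (4 : ENNReal).toReal = (4 : ℕ) := by norm_num
  rw [h4, Real.rpow_inv_natCast_pow (integral_nonneg fun _ => by positivity) (by norm_num)]
  simp only [Real.rpow_natCast]

theorem Lp_coeFn_sum {p : ENNReal} {ι : Type*} (s : Finset ι) (f : ι → Lp ℂ p μ) :
    ⇑(∑ j ∈ s, f j) =ᵐ[μ] fun ω => ∑ j ∈ s, f j ω := by
  classical
  induction s using Finset.induction_on with
  | empty => simp only [Finset.sum_empty]; exact Lp.coeFn_zero ℂ p μ
  | insert i s hi ih =>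
    rw [Finset.sum_insert hi]
    filter_upwards [Lp.coeFn_add (f i) (∑ j ∈ s, f j), ih] with ω h1 h2
    rw [h1, Pi.add_apply, h2, Finset.sum_insert hi]

variable [IsProbabilityMeasure μ]

theorem IsBPSK.coeFn_symbol (ha : IsBPSK μ a) (j : ℤ) :
    symbol ha j =ᵐ[μ] fun ω => (a j ω : ℂ) := (ha.memLp j).coeFn_toLp

theorem IsBPSK.coeFn_sum_symbol (ha : IsBPSK μ a) (c : ℤ → ℂ) (s : Finset ℤ) :
    ⇑(∑ j ∈ s, c j • symbol ha j) =ᵐ[μ] symbolSum a c s := by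
  filter_upwards [Lp_coeFn_sum s (fun j => c j • symbol ha j),
    ae_all_iff.2 fun j => Lp.coeFn_smul (c j) (symbol ha j),
    ae_all_iff.2 ha.coeFn_symbol] with ω h1 h2 h3
  rw [h1]
  refine Finset.sum_congr rfl fun j _ => ?_
  rw [h2, Pi.smul_apply, h3, smul_eq_mul]

theorem IsBPSK.integral_symbol_mul_symbol (ha : IsBPSK μ a) (i j : ℤ) :
    ∫ ω, (a i ω : ℂ) * a j ω ∂μ = if i = j then 1 else 0 := by
  split_ifs with h
  · subst h
    have : ∀ᵐ ω ∂μ, (a i ω : ℂ) * a i ω = 1 := by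
      filter_upwards [ha.values i] with ω h
      rcases h with h | h <;> simp [h]
    rw [integral_congr_ae this]
    simp
  · have := ha.integral_mul_symbol_eq_zero (fun _ => 1) (s := {i}) (i := j) (by simpa using Ne.symm h)
      (φ := fun z => z) continuous_id
    simpa [symbolSum] using this

theorem IsBPSK.orthonormal_symbol (ha : IsBPSK μ a) : Orthonormal ℂ (symbol ha) := by
  classical
  rw [orthonormal_iff_ite]
  intro i j
  rw [← integral_mul_conj_eq_inner, ← ha.integral_symbol_mul_symbol i j]
  refine integral_congr_ae ?_
  filter_upwards [ha.coeFn_symbol i, ha.coeFn_symbol j] with ω h1 h2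
  rw [h1, h2, Complex.conj_ofReal, mul_comm]

theorem IsBPSK.summable_smul_symbol (ha : IsBPSK μ a) {c : ℤ → ℂ}
    (hc : Summable fun j => ‖c j‖ ^ 2) : Summable fun j => c j • symbol ha j := by
  have := ha.orthonormal_symbol.orthogonalFamily.summable_iff_norm_sq_summable c
  simpa using this.2 hc

/-- The random variable `∑_j c_j a_j`. -/
def symbolSeries (ha : IsBPSK μ a) (c : ℤ → ℂ) : Lp ℂ 2 μ := ∑' j, c j • symbol ha j

theorem IsBPSK.hasSum_symbolSeries (ha : IsBPSK μ a) {c : ℤ → ℂ}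
    (hc : Summable fun j => ‖c j‖ ^ 2) :
    HasSum (fun j => c j • symbol ha j) (symbolSeries ha c) :=
  (ha.summable_smul_symbol hc).hasSum

theorem IsBPSK.inner_symbol_symbolSeries (ha : IsBPSK μ a) {c : ℤ → ℂ}
    (hc : Summable fun j => ‖c j‖ ^ 2) (i : ℤ) :
    inner ℂ (symbol ha i) (symbolSeries ha c) = c i := by
  classical
  have h := (ha.hasSum_symbolSeries hc).mapL (innerSL ℂ (symbol ha i))
  simp only [innerSL_apply_apply, inner_smul_right] at h
  refine h.unique ?_
  refine hasSum_congr (hasSum_ite_eq i (c i)) (fun j => ?_) rfl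
  rw [orthonormal_iff_ite.1 ha.orthonormal_symbol i j]
  by_cases hj : j = i
  · simp [hj]
  · rw [if_neg hj, if_neg (Ne.symm hj), mul_zero]

theorem IsBPSK.hasSum_inner_symbolSeries (ha : IsBPSK μ a) {c d : ℤ → ℂ}
    (hc : Summable fun j => ‖c j‖ ^ 2) (hd : Summable fun j => ‖d j‖ ^ 2) :
    HasSum (fun j => c j * conj (d j)) (inner ℂ (symbolSeries ha d) (symbolSeries ha c)) := by
  have h := (ha.hasSum_symbolSeries hc).mapL (innerSL ℂ (symbolSeries ha d))
  simp only [innerSL_apply_apply, inner_smul_right] at h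
  refine hasSum_congr h (fun j => ?_) rfl
  rw [← inner_conj_symm, ha.inner_symbol_symbolSeries hd]

theorem IsBPSK.hasSum_norm_sq_symbolSeries (ha : IsBPSK μ a) {c : ℤ → ℂ}
    (hc : Summable fun j => ‖c j‖ ^ 2) :
    HasSum (fun j => ‖c j‖ ^ 2) (‖symbolSeries ha c‖ ^ 2) := by
  have h := ha.hasSum_inner_symbolSeries hc hc
  simp only [Complex.mul_conj', inner_self_eq_norm_sq_to_K] at h
  rw [← Complex.hasSum_ofReal]
  push_cast
  exact h

theorem IsBPSK.symbolSeries_sub (ha : IsBPSK μ a) {c d : ℤ → ℂ}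
    (hc : Summable fun j => ‖c j‖ ^ 2) (hd : Summable fun j => ‖d j‖ ^ 2) :
    symbolSeries ha (fun j => c j - d j) = symbolSeries ha c - symbolSeries ha d := by
  simp only [symbolSeries, sub_smul]
  exact (ha.summable_smul_symbol hc).tsum_sub (ha.summable_smul_symbol hd)

/-- The expectation is the inner product with the constant 1, hence continuous on L², and each
symbol is centred. -/
theorem IsBPSK.integral_symbolSeries (ha : IsBPSK μ a) {c : ℤ → ℂ}
    (hc : Summable fun j => ‖c j‖ ^ 2) : ∫ ω, symbolSeries ha c ω ∂μ = 0 := by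
  set one : Lp ℂ 2 μ := (memLp_const (1 : ℂ)).toLp with h_one
  have key : ∀ x : Lp ℂ 2 μ, inner ℂ one x = ∫ ω, x ω ∂μ := by
    intro x
    rw [← integral_mul_conj_eq_inner]
    refine integral_congr_ae ?_
    filter_upwards [(memLp_const (μ := μ) (p := 2) (1 : ℂ)).coeFn_toLp] with ω h
    rw [h, map_one, mul_one]
  have h := (ha.hasSum_symbolSeries hc).mapL (innerSL ℂ one)
  simp only [map_smul, innerSL_apply_apply, key] at h
  refine h.unique (hasSum_congr hasSum_zero (fun j => ?_) rfl)
  rw [integral_congr_ae (ha.coeFn_symbol j), integral_complex_ofReal, ha.mean j]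
  simp

/-- The symbols are real, so conjugation, a continuous real-linear map of L², acts on the
coefficients alone. It reduces second moments without conjugate to inner products. -/
theorem IsBPSK.coeFn_symbolSeries_conj (ha : IsBPSK μ a) {c : ℤ → ℂ}
    (hc : Summable fun j => ‖c j‖ ^ 2) :
    symbolSeries ha (fun j => conj (c j)) =ᵐ[μ] fun ω => conj (symbolSeries ha c ω) := by
  set C := (Complex.conjCLE : ℂ ≃L[ℝ] ℂ).toContinuousLinearMap with hC
  have h := (ha.hasSum_symbolSeries hc).mapL (C.compLpL 2 μ)
  have h' := ha.hasSum_symbolSeries (c := fun j => conj (c j)) (by simpa using hc)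
  have e : ∀ j, C.compLpL 2 μ (c j • symbol ha j) = conj (c j) • symbol ha j := by
    intro j
    refine Lp.ext ?_
    filter_upwards [C.coeFn_compLpL (c j • symbol ha j), Lp.coeFn_smul (c j) (symbol ha j),
      Lp.coeFn_smul (conj (c j)) (symbol ha j), ha.coeFn_symbol j] with ω h1 h2 h3 h4
    rw [h1, h2, h3]
    simp [hC, h4]
  simp only [e] at h
  rw [h'.unique h]
  exact C.coeFn_compLpL _

theorem IsBPSK.hasSum_sq_symbolSeries (ha : IsBPSK μ a) {c : ℤ → ℂ}
    (hc : Summable fun j => ‖c j‖ ^ 2) :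
    HasSum (fun j => c j ^ 2) (∫ ω, symbolSeries ha c ω ^ 2 ∂μ) := by
  have h := ha.hasSum_inner_symbolSeries (d := fun j => conj (c j)) hc (by simpa using hc)
  rw [← integral_mul_conj_eq_inner] at h
  refine hasSum_congr h (fun j => ?_) (integral_congr_ae ?_)
  · rw [Complex.conj_conj, pow_two]
  · filter_upwards [ha.coeFn_symbolSeries_conj hc] with ω h
    rw [h, Complex.conj_conj, pow_two]

theorem IsBPSK.memLp_four (ha : IsBPSK μ a) (n : ℤ) : MemLp (fun ω => (a n ω : ℂ)) 4 μ := by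
  refine MemLp.of_bound (Complex.measurable_ofReal.comp (ha.measurable n)).aestronglyMeasurable 1 ?_
  filter_upwards [ha.values n] with ω h
  rcases h with h | h <;> simp [h]

/-- The symbol `a_j` as an element of `L⁴(Ω)`. -/
def symbolFour (ha : IsBPSK μ a) (j : ℤ) : Lp ℂ 4 μ := (ha.memLp_four j).toLp _

theorem IsBPSK.coeFn_sum_symbolFour (ha : IsBPSK μ a) (c : ℤ → ℂ) (s : Finset ℤ) :
    ⇑(∑ j ∈ s, c j • symbolFour ha j) =ᵐ[μ] symbolSum a c s := by
  filter_upwards [Lp_coeFn_sum s (fun j => c j • symbolFour ha j),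
    ae_all_iff.2 fun j => Lp.coeFn_smul (c j) (symbolFour ha j),
    ae_all_iff.2 fun j => (ha.memLp_four j).coeFn_toLp] with ω h1 h2 h3
  rw [h1]
  refine Finset.sum_congr rfl fun j _ => ?_
  rw [h2, Pi.smul_apply, symbolFour, h3, smul_eq_mul]

theorem IsBPSK.norm_pow_four_sum (ha : IsBPSK μ a) (c : ℤ → ℂ) (s : Finset ℤ) :
    ‖∑ j ∈ s, c j • symbolFour ha j‖ ^ 4 = ∫ ω, ‖symbolSum a c s ω‖ ^ 4 ∂μ := by
  rw [Lp_four_norm_pow]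
  refine integral_congr_ae ?_
  filter_upwards [ha.coeFn_sum_symbolFour c s] with ω h
  rw [h]

instance : Fact ((1 : ENNReal) ≤ 4) := ⟨by norm_num⟩

theorem IsBPSK.summable_smul_symbolFour (ha : IsBPSK μ a) {c : ℤ → ℂ}
    (hc : Summable fun j => ‖c j‖ ^ 2) : Summable fun j => c j • symbolFour ha j := by
  rw [summable_iff_vanishing_norm]
  intro ε hε
  -- The threshold works because `3 * (ε² / 2)² < ε⁴`.
  obtain ⟨s, hs⟩ := summable_iff_vanishing_norm.1 hc (ε ^ 2 / 2) (by positivity)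
  refine ⟨s, fun t ht => ?_⟩
  have h1 := hs t ht
  rw [Real.norm_of_nonneg (Finset.sum_nonneg fun _ _ => by positivity)] at h1
  have h0 : 0 ≤ ∑ j ∈ t, ‖c j‖ ^ 2 := Finset.sum_nonneg fun _ _ => by positivity
  refine lt_of_pow_lt_pow_left₀ 4 hε.le ?_
  rw [ha.norm_pow_four_sum]
  refine (ha.integral_norm_pow_four_symbolSum_le c t).trans_lt ?_
  have : (∑ j ∈ t, ‖c j‖ ^ 2) ^ 2 < (ε ^ 2 / 2) ^ 2 := pow_lt_pow_left₀ h1 h0 (by norm_num)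
  nlinarith [pow_pos hε 4]

/-- Both limits are limits in measure of the same partial sums. -/
theorem IsBPSK.symbolSeries_ae_eq_four (ha : IsBPSK μ a) {c : ℤ → ℂ}
    (hc : Summable fun j => ‖c j‖ ^ 2) :
    symbolSeries ha c =ᵐ[μ] (∑' j, c j • symbolFour ha j : Lp ℂ 4 μ) := by
  have h2 := tendstoInMeasure_of_tendsto_Lp (ha.hasSum_symbolSeries hc)
  have h4 := tendstoInMeasure_of_tendsto_Lp (ha.summable_smul_symbolFour hc).hasSum
  have h2' := h2.congr (fun s => ha.coeFn_sum_symbol c s) EventuallyEq.rfl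
  have h4' := h4.congr (fun s => ha.coeFn_sum_symbolFour c s) EventuallyEq.rfl
  exact tendstoInMeasure_ae_unique h2' h4'

theorem IsBPSK.memLp_four_symbolSeries (ha : IsBPSK μ a) {c : ℤ → ℂ}
    (hc : Summable fun j => ‖c j‖ ^ 2) : MemLp (symbolSeries ha c) 4 μ :=
  (memLp_congr_ae (ha.symbolSeries_ae_eq_four hc)).2 (Lp.memLp _)

theorem summable_norm_pow_four {ι : Type*} {c : ι → ℂ} (hc : Summable fun j => ‖c j‖ ^ 2) :
    Summable fun j => ‖c j‖ ^ 4 := by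
  refine (hc.mul_left (∑' j, ‖c j‖ ^ 2)).of_nonneg_of_le (fun _ => by positivity) fun j => ?_
  have := hc.le_tsum j fun _ _ => by positivity
  nlinarith [sq_nonneg ‖c j‖]

theorem IsBPSK.integral_norm_pow_four_symbolSeries (ha : IsBPSK μ a) {c : ℤ → ℂ}
    (hc : Summable fun j => ‖c j‖ ^ 2) :
    ∫ ω, ‖symbolSeries ha c ω‖ ^ 4 ∂μ =
      2 * (∑' j, ‖c j‖ ^ 2) ^ 2 + ‖∑' j, c j ^ 2‖ ^ 2 - 2 * ∑' j, ‖c j‖ ^ 4 := by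
  have h1 : ∫ ω, ‖symbolSeries ha c ω‖ ^ 4 ∂μ = ‖∑' j, c j • symbolFour ha j‖ ^ 4 := by
    rw [Lp_four_norm_pow]
    refine integral_congr_ae ?_
    filter_upwards [ha.symbolSeries_ae_eq_four hc] with ω h
    rw [h]
  have h2 : Tendsto (fun s : Finset ℤ => ‖∑ j ∈ s, c j • symbolFour ha j‖ ^ 4) atTop
      (𝓝 (‖∑' j, c j • symbolFour ha j‖ ^ 4)) :=
    ((ha.summable_smul_symbolFour hc).hasSum.norm).pow 4
  simp only [ha.norm_pow_four_sum, ha.integral_norm_pow_four_symbolSum] at h2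
  rw [h1]
  refine tendsto_nhds_unique h2 ?_
  have t1 : Tendsto (fun s : Finset ℤ => ∑ j ∈ s, ‖c j‖ ^ 2) atTop _ := hc.hasSum
  have t2 : Tendsto (fun s : Finset ℤ => ∑ j ∈ s, c j ^ 2) atTop _ :=
    (ha.hasSum_sq_symbolSeries hc).summable.hasSum
  have t3 : Tendsto (fun s : Finset ℤ => ∑ j ∈ s, ‖c j‖ ^ 4) atTop _ :=
    (summable_norm_pow_four hc).hasSum
  exact (((t1.pow 2).const_mul 2).add (t2.norm.pow 2)).sub (t3.const_mul 2)

/-- The fourth order cumulant of a linear combination of BPSK symbols. -/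
theorem IsBPSK.cum4_symbolSeries (ha : IsBPSK μ a) {c : ℤ → ℂ}
    (hc : Summable fun j => ‖c j‖ ^ 2) :
    cum4 μ (symbolSeries ha c) = -2 * ∑' j, ‖c j‖ ^ 4 := by
  have h2 : ∫ ω, ‖symbolSeries ha c ω‖ ^ 2 ∂μ = ∑' j, ‖c j‖ ^ 2 := by
    rw [(ha.hasSum_norm_sq_symbolSeries hc).tsum_eq]
    have := integral_mul_conj_eq_inner (symbolSeries ha c) (symbolSeries ha c)
    simp only [Complex.mul_conj', inner_self_eq_norm_sq_to_K] at this
    have e : ∫ ω, (‖symbolSeries ha c ω‖ : ℂ) ^ 2 ∂μ =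
        ((∫ ω, ‖symbolSeries ha c ω‖ ^ 2 ∂μ : ℝ) : ℂ) := by
      rw [← integral_complex_ofReal]; simp
    rw [e] at this
    exact Complex.ofReal_injective (by push_cast; exact this)
  rw [cum4]
  simp only [ha.integral_symbolSeries hc, sub_zero]
  rw [ha.integral_norm_pow_four_symbolSeries hc, h2, (ha.hasSum_sq_symbolSeries hc).tsum_eq]
  ring

end SymbolSeries

/-! ### Time averages and generic sampling rates -/

theorem partialAvg_const (c : ℂ) (N : ℕ) : partialAvg (fun _ : ℤ => c) N = c := by
  have : (2 * (N : ℂ) + 1) ≠ 0 := by exact_mod_cast (by omega : 2 * N + 1 ≠ 0)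
  rw [partialAvg, Finset.sum_const, Int.card_Icc, Complex.real_smul, nsmul_eq_mul]
  have e : ((N : ℤ) + 1 - -(N : ℤ)).toNat = 2 * N + 1 := by omega
  rw [e]
  push_cast
  field_simp

theorem partialAvg_sum {ι : Type*} (s : Finset ι) (u : ι → ℤ → ℂ) (N : ℕ) :
    partialAvg (fun n => ∑ i ∈ s, u i n) N = ∑ i ∈ s, partialAvg (u i) N := by
  simp only [partialAvg]
  rw [Finset.sum_comm, Finset.smul_sum]

theorem partialAvg_mul_left (c : ℂ) (u : ℤ → ℂ) (N : ℕ) :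
    partialAvg (fun n => c * u n) N = c * partialAvg u N := by
  simp only [partialAvg]
  rw [← Finset.mul_sum, mul_smul_comm]

/-- The geometric sums stay bounded by `2 / ‖w - 1‖`, while the number of terms grows. -/
theorem tendsto_partialAvg_exp {θ : ℝ} (hθ : ∀ k : ℤ, θ ≠ k) :
    Tendsto (partialAvg fun n : ℤ => Complex.exp (2 * Real.pi * Complex.I * θ * n)) atTop (𝓝 0) := by
  set w := Complex.exp (2 * Real.pi * Complex.I * θ) with hw
  have hw0 : w ≠ 0 := Complex.exp_ne_zero _
  have hn : ‖w‖ = 1 := by simpa using norm_exp_two_pi θ 1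
  have hw1 : w ≠ 1 := by
    intro h
    rw [hw, Complex.exp_eq_one_iff] at h
    obtain ⟨k, hk⟩ := h
    rw [mul_comm (k : ℂ)] at hk
    exact hθ k (by exact_mod_cast mul_left_cancel₀ Complex.two_pi_I_ne_zero hk)
  have e : ∀ n : ℤ, Complex.exp (2 * Real.pi * Complex.I * θ * n) = w ^ n := by
    intro n
    rw [hw, ← Complex.exp_int_mul]
    congr 1; ring
  have hp : 0 < ‖w - 1‖ := norm_pos_iff.2 (sub_ne_zero.2 hw1)
  have hb : ∀ N : ℕ, ‖partialAvg (fun n : ℤ => Complex.exp (2 * Real.pi * Complex.I * θ * n)) N‖ ≤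
      (2 / ‖w - 1‖) * (1 / ((N : ℝ) + 1)) := by
    intro N
    simp only [e, partialAvg]
    rw [sum_Icc_zpow hw0, geom_sum_eq hw1, norm_smul, norm_mul, norm_zpow, hn, one_zpow, one_mul,
      Real.norm_of_nonneg (by positivity), mul_comm]
    have h2 : ‖w ^ (2 * N + 1) - 1‖ ≤ 2 := by
      refine (norm_sub_le _ _).trans ?_
      rw [norm_pow, hn]; norm_num
    rw [norm_div]
    gcongr
    linarith [(Nat.cast_nonneg N : (0 : ℝ) ≤ N)]
  refine squeeze_zero_norm hb ?_
  simpa using tendsto_one_div_add_atTop_nhds_zero_nat.const_mul (2 / ‖w - 1‖)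

/-- Time averages of trigonometric polynomials. -/
theorem tendsto_partialAvg_trig {s : Finset ℤ} {l : ℤ} (hl : l ∈ s) {α : ℝ}
    (hα : ∀ m ∈ s, m ≠ l → ∀ k : ℤ, ((m - l : ℤ) : ℝ) * α ≠ k) (C : ℤ → ℂ) :
    Tendsto (partialAvg fun n : ℤ =>
      (∑ m ∈ s, C m * Complex.exp (2 * Real.pi * Complex.I * m * (n * α))) *
        Complex.exp (-(2 * Real.pi * Complex.I * n * (l * α)))) atTop (𝓝 (C l)) := by
  have e : (partialAvg fun n : ℤ =>
      (∑ m ∈ s, C m * Complex.exp (2 * Real.pi * Complex.I * m * (n * α))) *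
        Complex.exp (-(2 * Real.pi * Complex.I * n * (l * α)))) = fun N => ∑ m ∈ s,
      C m * partialAvg (fun n : ℤ =>
        Complex.exp (2 * Real.pi * Complex.I * (((m - l : ℤ) : ℝ) * α : ℝ) * n)) N := by
    ext N
    simp only [← partialAvg_mul_left]
    rw [← partialAvg_sum]
    congr 1 with n
    rw [Finset.sum_mul]
    refine Finset.sum_congr rfl fun m _ => ?_
    rw [mul_assoc, ← Complex.exp_add]
    congr 2
    push_cast
    ring
  rw [e, ← Finset.sum_ite_eq_of_mem' s l C hl]
  refine tendsto_finsetSum _ fun m hm => ?_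
  split_ifs with h
  · subst h
    simp [partialAvg_const]
  · simpa using (tendsto_partialAvg_exp (hα m hm h)).const_mul (C m)

/-- A failure would make `α` a fraction `k / d` in `(0, 1)` with `d ≤ 3`, hence one of `1/2`, `1/3`,
`2/3`. The bound 3 is the largest gap between a harmonic present and the one to be isolated. -/
theorem mul_ne_int_of_generic {α : ℝ} (h0 : 0 < α) (h1 : α < 1) (h2 : α ≠ 1 / 2) (h3 : α ≠ 1 / 3)
    (h4 : α ≠ 2 / 3) {d : ℤ} (hd : d ≠ 0) (hd3 : |d| ≤ 3) (k : ℤ) : (d : ℝ) * α ≠ k := by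
  have key : ∀ d : ℤ, 0 < d → d ≤ 3 → ∀ k : ℤ, (d : ℝ) * α ≠ k := by
    intro d hd hd3 k h
    have hd' : (0 : ℝ) < d := by exact_mod_cast hd
    have hk0 : (0 : ℝ) < k := by rw [← h]; positivity
    have hk1 : (k : ℝ) < d := by rw [← h]; nlinarith
    have hk0 : 0 < k := by exact_mod_cast hk0
    have hk1 : k < d := by exact_mod_cast hk1
    interval_cases d <;> interval_cases k <;> norm_num at h
    · exact h2 (by linarith)
    · exact h3 (by linarith)
    · exact h4 (by linarith)
  rw [abs_le] at hd3
  rcases lt_or_gt_of_ne hd with h | h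
  · intro h'
    refine key (-d) (by omega) (by omega) (-k) ?_
    push_cast
    linarith
  · exact key d h hd3.2 k

/-! The signal with pulse `invFT F` -/

theorem IsSpectrum.summable_normSq_lattice {b T : ℝ} (hb : 0 < b) (hT : 0 < T) {F : ℝ → ℂ}
    (hF : IsSpectrum b F) (t : ℝ) : Summable fun j : ℤ => ‖invFT F (t - j * T)‖ ^ 2 := by
  obtain ⟨K, hK⟩ := exists_nat_ge (2 * b * T)
  have h := (hF.hasSum_lattice hb hT (hK.trans (by linarith : (K : ℝ) ≤ K + 1)) hF t).summable
  simp only [Complex.mul_conj'] at h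
  exact_mod_cast h

section Pulse

variable {Ω : Type*} [MeasurableSpace Ω] {μ : Measure Ω} [IsProbabilityMeasure μ] {a : ℤ → Ω → ℝ}

/-- The samples at the instants `n T_e` of the signal `∑_j a_j f(t - jT)` where `f = invFT F`. -/
def pulseSignal (ha : IsBPSK μ a) (T Te : ℝ) (F : ℝ → ℂ) (n : ℤ) : Lp ℂ 2 μ :=
  symbolSeries ha fun j => invFT F (n * Te - j * T)

/-- Sampling periods for which the time averages isolate the cyclic frequencies. -/
structure IsGenericRate (α : ℝ) : Prop where
  pos : 0 < α
  lt_one : α < 1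
  ne_half : α ≠ 1 / 2
  ne_third : α ≠ 1 / 3
  ne_two_thirds : α ≠ 2 / 3

theorem IsGenericRate.mul_ne_int {α : ℝ} (h : IsGenericRate α) {d : ℤ} (hd : d ≠ 0) (hd3 : |d| ≤ 3)
    (k : ℤ) : (d : ℝ) * α ≠ k :=
  mul_ne_int_of_generic h.pos h.lt_one h.ne_half h.ne_third h.ne_two_thirds hd hd3 k

variable {b T Te : ℝ} {F : ℝ → ℂ}

/-- The correlation at time `n` is the lattice sum at `n * Te` of `f(· + m * Te) * conj f`, a
trigonometric polynomial of degree at most 1; genericity of the rate isolates its `l`-th harmonic.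
-/
theorem IsBPSK.tendsto_cyclicCorrSeq (ha : IsBPSK μ a) (hb : 0 < b) (hT : 0 < T)
    (hbT : 2 * b * T ≤ 2) (hF : IsSpectrum b F) (hα : IsGenericRate (Te / T)) {l : ℤ}
    (hl : |l| ≤ 1) (m : ℤ) :
    Tendsto (partialAvg (cyclicCorrSeq (pulseSignal ha T Te F) (l * (Te / T)) m)) atTop
      (𝓝 (latticeCoeff T (fun u => invFT F (u + m * Te) * conj (invFT F u)) l)) := by
  have hl' := abs_le.1 hl
  have h := tendsto_partialAvg_trig (s := Finset.Icc (-1) 1) (Finset.mem_Icc.2 ⟨hl'.1, hl'.2⟩)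
    (α := Te / T) (fun m hm hml => hα.mul_ne_int (by omega) (by
      have := Finset.mem_Icc.1 hm
      rw [abs_le]; omega))
    (latticeCoeff T (fun u => invFT F (u + m * Te) * conj (invFT F u)))
  refine h.congr fun N => ?_
  congr 1 with n
  rw [cyclicCorrSeq, integral_mul_conj_eq_inner]
  have hs := ha.hasSum_inner_symbolSeries
    (hF.summable_normSq_lattice hb hT (((n + m : ℤ) : ℝ) * Te))
    (hF.summable_normSq_lattice hb hT (n * Te))
  have hs' := (hF.exp_mul (m * Te)).hasSum_lattice hb hT (K := 1) (by norm_num; exact hbT) hF (n * Te)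
  simp only [invFT_exp_mul] at hs'
  have e : ∀ j : ℤ, (n : ℝ) * Te - j * T + m * Te = ((n + m : ℤ) : ℝ) * Te - j * T := by
    intro j; push_cast; ring
  simp only [e] at hs'
  rw [pulseSignal, pulseSignal, hs.unique hs']
  push_cast
  simp only [mul_div_assoc]

theorem IsBPSK.tendsto_nonConjCorrSeq (ha : IsBPSK μ a) (hb : 0 < b) (hT : 0 < T)
    (hbT : 2 * b * T ≤ 2) (hF : IsSpectrum b F) (hα : IsGenericRate (Te / T)) {l : ℤ}
    (hl : |l| ≤ 1) :
    Tendsto (partialAvg (nonConjCorrSeq (pulseSignal ha T Te F) (l * (Te / T)) 0)) atTop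
      (𝓝 (latticeCoeff T (fun u => invFT F u ^ 2) l)) := by
  have hl' := abs_le.1 hl
  have h := tendsto_partialAvg_trig (s := Finset.Icc (-1) 1) (Finset.mem_Icc.2 ⟨hl'.1, hl'.2⟩)
    (α := Te / T) (fun m hm hml => hα.mul_ne_int (by omega) (by
      have := Finset.mem_Icc.1 hm
      rw [abs_le]; omega))
    (latticeCoeff T (fun u => invFT F u ^ 2))
  refine h.congr fun N => ?_
  congr 1 with n
  rw [nonConjCorrSeq]
  simp only [add_zero, ← pow_two]
  have hs := ha.hasSum_sq_symbolSeries (hF.summable_normSq_lattice hb hT (n * Te))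
  -- With `conj (F (-ν))` as second spectrum, the product becomes `f²`.
  have hs' := hF.hasSum_lattice hb hT (K := 1) (by norm_num; exact hbT) hF.conj_neg (n * Te)
  simp only [invFT_conj_neg, Complex.conj_conj, ← pow_two] at hs'
  rw [pulseSignal, hs.unique hs']
  push_cast
  simp only [mul_div_assoc]

theorem latticeCoeff_ofReal_zero (T : ℝ) (φ : ℝ → ℝ) :
    latticeCoeff T (fun u => (φ u : ℂ)) 0 = ((T⁻¹ * ∫ u, φ u : ℝ) : ℂ) := by
  simp [latticeCoeff, integral_complex_ofReal]

/-- The cumulant at time `n` is `-2` times a lattice sum of `|f|⁴`, and the average keeps only the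
constant harmonic of that sum. -/
theorem IsBPSK.tendsto_cum4 (ha : IsBPSK μ a) (hb : 0 < b) (hT : 0 < T)
    (hbT : 2 * b * T ≤ 2) (hF : IsSpectrum b F) (hα : IsGenericRate (Te / T)) :
    Tendsto (partialAvg fun n => cum4 μ (pulseSignal ha T Te F n)) atTop
      (𝓝 (-2 * (T⁻¹ * ∫ t, ‖invFT F t‖ ^ 4))) := by
  have hFF := hF.convolution hF
  have h := tendsto_partialAvg_trig (s := Finset.Icc (-3) 3) (l := 0) (by simp)
    (α := Te / T) (fun m hm hml => hα.mul_ne_int (by omega) (by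
      have := Finset.mem_Icc.1 hm
      rw [abs_le]; omega))
    (latticeCoeff T (fun u => ((‖invFT F u‖ ^ 4 : ℝ) : ℂ)))
  rw [latticeCoeff_ofReal_zero] at h
  have h' := ((Complex.continuous_re.tendsto _).comp h).const_mul (-2)
  rw [Complex.ofReal_re] at h'
  refine h'.congr fun N => ?_
  simp only [Function.comp_apply]
  have e : ∀ z : ℂ, z ^ 2 * conj (z ^ 2) = ((‖z‖ ^ 4 : ℝ) : ℂ) := by
    intro z
    rw [Complex.mul_conj', norm_pow]; push_cast; ring
  have key : ∀ n : ℤ, (∑ m ∈ Finset.Icc (-3 : ℤ) 3,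
      latticeCoeff T (fun u => ((‖invFT F u‖ ^ 4 : ℝ) : ℂ)) m *
        Complex.exp (2 * Real.pi * Complex.I * m * (n * (Te / T : ℝ)))) *
      Complex.exp (-(2 * Real.pi * Complex.I * n * ((0 : ℤ) * (Te / T : ℝ)))) =
      ((∑' j : ℤ, ‖invFT F (n * Te - j * T)‖ ^ 4 : ℝ) : ℂ) := by
    intro n
    -- The spectrum of `f²` has half-width `2 * b`, and `2 * (2 * b) * T ≤ 4`, so harmonics up to
    -- degree 3 suffice.
    have hs := hFF.hasSum_lattice (by positivity) hT (K := 3) (by norm_num; linarith) hFF (n * Te)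
    simp only [hF.invFT_convolution hF, ← pow_two, e] at hs
    have hs' := Complex.hasSum_ofReal.2
      (summable_norm_pow_four (hF.summable_normSq_lattice hb hT (n * Te))).hasSum
    rw [hs'.unique hs]
    push_cast
    simp [mul_div_assoc]
  simp only [key]
  simp only [partialAvg, pulseSignal]
  simp only [ha.cum4_symbolSeries (hF.summable_normSq_lattice hb hT _)]
  rw [← Finset.mul_sum, ← Complex.ofReal_sum, Complex.real_smul, ← Complex.ofReal_mul,
    Complex.ofReal_re, smul_eq_mul]
  ring

theorem timeAvg_eq_of_tendsto {E : Type*} [NormedAddCommGroup E] [NormedSpace ℝ E] {u : ℤ → E} {L : E}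
    (h : Tendsto (partialAvg u) atTop (𝓝 L)) : timeAvg u = L := h.limUnder_eq

theorem IsBPSK.avgCum4_pulseSignal (ha : IsBPSK μ a) (hb : 0 < b) (hT : 0 < T)
    (hbT : 2 * b * T ≤ 2) (hF : IsSpectrum b F) (hα : IsGenericRate (Te / T))
    (hE : energy (invFT F) = T) : avgCum4 (pulseSignal ha T Te F) = Psi T (invFT F) := by
  rw [avgCum4, timeAvg_eq_of_tendsto (ha.tendsto_cum4 hb hT hbT hF hα), Psi, hE, kappa]
  field_simp

theorem IsBPSK.betaPrimeExists_pulseSignal (ha : IsBPSK μ a) (hb : 0 < b) (hT : 0 < T)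
    (hbT : 2 * b * T ≤ 2) (hF : IsSpectrum b F) (hα : IsGenericRate (Te / T)) :
    BetaPrimeExists (Te / T) (pulseSignal ha T Te F) := by
  refine ⟨fun n => ha.memLp_four_symbolSeries (hF.summable_normSq_lattice hb hT _),
    ⟨_, ha.tendsto_cum4 hb hT hbT hF hα⟩, ?_, ?_, ?_, ?_⟩
  · exact ⟨_, by simpa using ha.tendsto_cyclicCorrSeq hb hT hbT hF hα (l := -1) (by simp) 0⟩
  · exact ⟨_, by simpa using ha.tendsto_cyclicCorrSeq hb hT hbT hF hα (l := 1) (by simp) 0⟩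
  · exact ⟨_, by simpa using ha.tendsto_nonConjCorrSeq hb hT hbT hF hα (l := -1) (by simp)⟩
  · exact ⟨_, by simpa using ha.tendsto_nonConjCorrSeq hb hT hbT hF hα (l := 1) (by simp)⟩

theorem norm_latticeCoeff {T : ℝ} (hT : 0 < T) (φ : ℝ → ℂ) (m : ℤ) :
    ‖latticeCoeff T φ m‖ =
      ‖∫ u : ℝ, φ u * Complex.exp (-(2 * Real.pi * Complex.I * m * (u / T)))‖ / T := by
  rw [latticeCoeff, norm_mul, norm_inv, Complex.norm_real, Real.norm_of_nonneg hT.le]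
  field_simp

theorem norm_latticeCoeff_neg_of_real (T : ℝ) (φ : ℝ → ℝ) (m : ℤ) :
    ‖latticeCoeff T (fun u => (φ u : ℂ)) (-m)‖ = ‖latticeCoeff T (fun u => (φ u : ℂ)) m‖ := by
  rw [← RCLike.norm_conj, latticeCoeff, latticeCoeff, map_mul, ← integral_conj]
  congr 2
  · simp
  · congr 1 with u
    rw [map_mul, Complex.conj_ofReal, ← Complex.exp_conj]
    simp [Complex.conj_ofNat]

theorem IsBPSK.betaPrime_pulseSignal (ha : IsBPSK μ a) (hb : 0 < b) (hT : 0 < T)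
    (hbT : 2 * b * T ≤ 2) (hF : IsSpectrum b F) (hα : IsGenericRate (Te / T))
    (hE : energy (invFT F) = T) :
    betaPrime (Te / T) (pulseSignal ha T Te F) = PhiPrime T (invFT F) := by
  have c1 := timeAvg_eq_of_tendsto (ha.tendsto_cyclicCorrSeq hb hT hbT hF hα (l := 1) (by simp) 0)
  have c2 := timeAvg_eq_of_tendsto (ha.tendsto_cyclicCorrSeq hb hT hbT hF hα (l := -1) (by simp) 0)
  have n1 := timeAvg_eq_of_tendsto (ha.tendsto_nonConjCorrSeq hb hT hbT hF hα (l := 1) (by simp))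
  have n2 := timeAvg_eq_of_tendsto (ha.tendsto_nonConjCorrSeq hb hT hbT hF hα (l := -1) (by simp))
  have e : (fun u => invFT F (u + ((0 : ℤ) : ℝ) * Te) * conj (invFT F u)) =
      fun u => ((‖invFT F u‖ ^ 2 : ℝ) : ℂ) := by
    ext u
    simp [Complex.mul_conj']
  rw [e] at c1 c2
  -- Since `|f|²` is real, its coefficients at `±1` have the same modulus; the factor 2 in `β'` thus
  -- becomes the factor 4 in `Φ'`.
  have c2' := norm_latticeCoeff_neg_of_real T (fun u => ‖invFT F u‖ ^ 2) 1
  rw [← c2, ← c1] at c2'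
  have c1' := congrArg norm c1
  have n1' := congrArg norm n1
  have n2' := congrArg norm n2
  rw [norm_latticeCoeff hT] at c1' n1' n2'
  simp only [Int.cast_one, Int.cast_neg, one_mul, mul_one, neg_mul, mul_neg, neg_neg] at c1' c2' n1' n2'
  rw [betaPrime, ha.avgCum4_pulseSignal hb hT hbT hF hα hE, cyclicCorr, cyclicCorr, nonConjCorr,
    nonConjCorr, c2', c1', n1', n2', PhiPrime, hE, norm_div, Complex.norm_real,
    Real.norm_of_nonneg hT.le]
  ring

end Pulse

/-! ### Uniqueness of Fourier coefficients and density of FIR filters -/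

/-- An integrable function on a period whose Fourier coefficients all vanish is zero. -/
theorem ae_eq_zero_of_fourier_eq_zero {L a : ℝ} [hL : Fact (0 < L)] {D : ℝ → ℂ}
    (hD : IntegrableOn D (Ioc a (a + L)))
    (h : ∀ n : ℤ, ∫ ν in Ioc a (a + L), fourier n (ν : AddCircle L) * D ν = 0) :
    ∀ᵐ ν ∂volume.restrict (Ioc a (a + L)), D ν = 0 := by
  have hi : ∀ φ : C(AddCircle L, ℂ),
      IntegrableOn (fun ν : ℝ => φ (ν : AddCircle L) * D ν) (Ioc a (a + L)) := fun φ =>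
    hD.bdd_mul (c := ‖φ‖) (φ.continuous.comp (AddCircle.continuous_mk' L)).aestronglyMeasurable
      (.of_forall fun ν => φ.norm_coe_le_norm _)
  let Λ₀ : C(AddCircle L, ℂ) →ₗ[ℂ] ℂ :=
    { toFun := fun φ => ∫ ν in Ioc a (a + L), φ (ν : AddCircle L) * D ν
      map_add' := fun φ ψ => by
        simp only [ContinuousMap.add_apply, add_mul]
        exact integral_add (hi φ) (hi ψ)
      map_smul' := fun c φ => by
        simp only [ContinuousMap.smul_apply, smul_eq_mul, mul_assoc, RingHom.id_apply]
        exact integral_const_mul _ _ }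
  let Λ : C(AddCircle L, ℂ) →L[ℂ] ℂ := Λ₀.mkContinuous (∫ ν in Ioc a (a + L), ‖D ν‖) fun φ => by
    refine (norm_integral_le_of_norm_le (hD.norm.const_mul ‖φ‖) (.of_forall fun ν => ?_)).trans
      (le_of_eq ?_)
    · rw [norm_mul]
      exact mul_le_mul_of_nonneg_right (φ.norm_coe_le_norm _) (norm_nonneg _)
    · rw [integral_const_mul, mul_comm]
  have hΛ : ∀ φ, Λ φ = ∫ ν in Ioc a (a + L), φ (ν : AddCircle L) * D ν := fun _ => rfl
  -- `D` is merely integrable, so the L² basis is not available; the density of trigonometric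
  -- polynomials among continuous functions is used through this functional.
  have hker : Λ = 0 := by
    have hd : Dense (Submodule.span ℂ (range (@fourier L)) : Set C(AddCircle L, ℂ)) := by
      rw [Submodule.dense_iff_topologicalClosure_eq_top]
      exact span_fourier_closure_eq_top
    refine ContinuousLinearMap.ext_on hd ?_
    rintro _ ⟨n, rfl⟩
    rw [hΛ, h n]
    rfl
  have hloc : LocallyIntegrableOn D (Ioo a (a + L)) :=
    (hD.mono_set Ioo_subset_Ioc_self).locallyIntegrableOn
  -- A test function supported in the open interval vanishes at both ends, so it defines a
  -- continuous function on the circle.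
  have key := isOpen_Ioo.ae_eq_zero_of_integral_contDiff_smul_eq_zero hloc (fun g hg _ hsupp => by
    have hz : ∀ x, x ∉ Ioo a (a + L) → g x = 0 := fun x hx => by
      by_contra h'
      exact hx (hsupp (subset_tsupport g h'))
    have hc : Continuous (AddCircle.liftIoc L a fun x => (g x : ℂ)) := by
      refine AddCircle.liftIoc_continuous ?_
        (Complex.continuous_ofReal.comp hg.continuous).continuousOn
      rw [hz a (by simp), hz (a + L) (by simp)]
    have h0 : Λ ⟨_, hc⟩ = 0 := by rw [hker]; rfl
    rw [hΛ] at h0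
    rw [← h0, ← setIntegral_eq_integral_of_forall_compl_eq_zero (s := Ioc a (a + L))]
    · refine setIntegral_congr_fun measurableSet_Ioc fun ν hν => ?_
      simp only [ContinuousMap.coe_mk]
      rw [AddCircle.liftIoc_coe_apply hν, Complex.real_smul]
    · intro x hx
      rw [hz x fun h' => hx (Ioo_subset_Ioc_self h'), zero_smul])
  rw [← restrict_Ioo_eq_restrict_Ioc]
  exact (ae_restrict_iff' measurableSet_Ioo).2 key

/-- Shannon's condition places the support inside one period of length `1 / Te`, so there is no
aliasing. -/
theorem ae_eq_zero_of_integral_exp_eq_zero {b Te : ℝ} (hTe : 0 < Te) (hb : b * Te ≤ 1 / 2)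
    {D : ℝ → ℂ} (hD : Integrable D) (hD0 : ∀ ν, ν ∉ Icc (-b) b → D ν = 0)
    (h : ∀ l : ℤ, ∫ ν : ℝ, Complex.exp (2 * Real.pi * Complex.I * l * (Te * ν)) * D ν = 0) :
    ∀ᵐ ν, D ν = 0 := by
  have hL : Fact (0 < 1 / Te) := ⟨by positivity⟩
  have hb' : b ≤ 1 / Te / 2 := by
    rw [div_div, le_div_iff₀ (by positivity)]; linarith
  have e1 : -(1 / Te / 2) + 1 / Te = 1 / Te / 2 := by ring
  have hz : ∀ ν, ν ∉ Icc (-(1 / Te / 2)) (1 / Te / 2) → D ν = 0 := fun ν hν =>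
    hD0 ν fun h' => hν ⟨by linarith [h'.1], by linarith [h'.2]⟩
  have hab : -(1 / Te / 2) ≤ 1 / Te / 2 := by linarith [hL.out]
  have key := ae_eq_zero_of_fourier_eq_zero (L := 1 / Te) (a := -(1 / Te / 2)) (D := D)
    hD.integrableOn (fun n => by
      rw [e1, ← h n, integral_eq_intervalIntegral_of_eq_zero hab
        (fun ν hν => by rw [hz ν hν, mul_zero]), intervalIntegral.integral_of_le hab]
      congr 1 with ν
      rw [fourier_coe_apply]
      congr 2
      push_cast
      field_simp)
  rw [e1, restrict_Ioc_eq_restrict_Icc] at key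
  filter_upwards [(ae_restrict_iff' measurableSet_Icc).1 key] with ν hν
  by_cases h' : ν ∈ Icc (-(1 / Te / 2)) (1 / Te / 2)
  · exact hν h'
  · exact hz ν h'

theorem Lp_two_norm_sq {α : Type*} [MeasurableSpace α] {μ : Measure α} (x : Lp ℂ 2 μ) :
    ‖x‖ ^ 2 = ∫ ω, ‖x ω‖ ^ 2 ∂μ := by
  have := integral_mul_conj_eq_inner x x
  simp only [Complex.mul_conj', inner_self_eq_norm_sq_to_K] at this
  have e : ∫ ω, (‖x ω‖ : ℂ) ^ 2 ∂μ = ((∫ ω, ‖x ω‖ ^ 2 ∂μ : ℝ) : ℂ) := by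
    rw [← integral_complex_ofReal]; simp
  rw [e] at this
  exact Complex.ofReal_injective (by push_cast; exact this.symm)

theorem firTransfer_mul_eq (h : ℤ →₀ ℂ) (G : ℝ → ℂ) (Te ν : ℝ) :
    G ν * firTransfer h (Te * ν) = ∑ l ∈ h.support,
      h l * (Complex.exp (2 * Real.pi * Complex.I * ν * ((-(l * Te) : ℝ) : ℂ)) * G ν) := by
  rw [firTransfer, Finsupp.sum, Finset.mul_sum]
  refine Finset.sum_congr rfl fun l _ => ?_
  rw [show (2 * Real.pi * Complex.I * ν * ((-(l * Te) : ℝ) : ℂ) : ℂ) =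
    -(2 * Real.pi * Complex.I * l * ((Te * ν : ℝ) : ℂ)) by push_cast; ring]
  ring

/-- Trigonometric polynomials times `G` are dense among the square integrable functions on the
band if `G` does not vanish on it. -/
theorem IsSpectrum.exists_firTransfer_approx {b Te : ℝ} (hTe : 0 < Te) (hb : b * Te ≤ 1 / 2)
    {F G : ℝ → ℂ} (hF : IsSpectrum b F) (hG : IsSpectrum b G)
    (hG0 : ∀ᵐ ν ∂volume.restrict (Icc (-b) b), G ν ≠ 0) {ε : ℝ} (hε : 0 < ε) :
    ∃ h : ℤ →₀ ℂ, ∫ ν, ‖F ν - G ν * firTransfer h (Te * ν)‖ ^ 2 < ε := by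
  set ρ := volume.restrict (Icc (-b) b) with hρ
  have hv : ∀ l : ℤ, MemLp (fun ν : ℝ =>
      Complex.exp (2 * Real.pi * Complex.I * ν * ((-(l * Te) : ℝ) : ℂ)) * G ν) 2 ρ := fun l =>
    (memLp_exp_mul hG.memLp _).restrict _
  let v : ℤ → Lp ℂ 2 ρ := fun l => (hv l).toLp
  -- If `u` is orthogonal to every exponential times `G`, all Fourier coefficients of the integrable
  -- function `u * conj G` vanish. Hence it is zero, and so is `u` because `G` is nonzero almost
  -- everywhere.
  have hK : (Submodule.span ℂ (range v)).topologicalClosure = ⊤ := by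
    rw [Submodule.topologicalClosure_eq_top_iff, Submodule.eq_bot_iff]
    intro u hu
    have hu' : ∀ l, ∫ ν, u ν * conj (v l ν) ∂ρ = 0 := fun l => by
      rw [integral_mul_conj_eq_inner]
      exact (Submodule.mem_orthogonal _ _).1 hu _ (Submodule.subset_span ⟨l, rfl⟩)
    have hi : Integrable (fun ν => u ν * conj (G ν)) ρ :=
      integrable_mul_conj (Lp.memLp u) (hG.memLp.restrict _)
    have key := ae_eq_zero_of_integral_exp_eq_zero hTe hb
      (D := (Icc (-b) b).indicator fun ν => u ν * conj (G ν))
      ((integrable_indicator_iff measurableSet_Icc).2 hi)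
      (fun ν hν => indicator_of_notMem hν _) (fun l => by
        rw [← hu' l]
        rw [← setIntegral_eq_integral_of_forall_compl_eq_zero (s := Icc (-b) b)
          fun ν hν => by rw [indicator_of_notMem hν, mul_zero]]
        refine integral_congr_ae ?_
        filter_upwards [(hv l).coeFn_toLp, ae_restrict_mem measurableSet_Icc] with ν hν hm
        rw [hν, indicator_of_mem hm, map_mul, conj_exp_two_pi]
        rw [show (-(2 * Real.pi * Complex.I * ν * ((-(l * Te) : ℝ) : ℂ)) : ℂ) =
          2 * Real.pi * Complex.I * l * (Te * ν) by push_cast; ring]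
        ring)
    refine Lp.ext ?_
    filter_upwards [Lp.coeFn_zero ℂ 2 ρ, hG0, ae_restrict_of_ae key,
      ae_restrict_mem measurableSet_Icc] with ν h0 h1 h2 h3
    rw [h0, Pi.zero_apply]
    rw [indicator_of_mem h3] at h2
    exact (mul_eq_zero.1 h2).resolve_right (by simpa using h1)
  have hF' := hF.memLp.restrict (Icc (-b) b)
  have hmem : hF'.toLp ∈ closure (Submodule.span ℂ (range v) : Set (Lp ℂ 2 ρ)) := by
    rw [← Submodule.topologicalClosure_coe, hK]; trivial
  obtain ⟨k, hk, hd⟩ := Metric.mem_closure_iff.1 hmem (Real.sqrt ε) (Real.sqrt_pos.2 hε)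
  obtain ⟨h, rfl⟩ := Finsupp.mem_span_range_iff_exists_finsupp.1 hk
  refine ⟨h, ?_⟩
  have h1 : ‖hF'.toLp - h.sum fun i c => c • v i‖ ^ 2 < ε := by
    rw [dist_eq_norm] at hd
    calc _ < Real.sqrt ε ^ 2 := pow_lt_pow_left₀ hd (norm_nonneg _) (by norm_num)
      _ = ε := Real.sq_sqrt hε.le
  refine lt_of_eq_of_lt ?_ h1
  rw [Lp_two_norm_sq, ← setIntegral_eq_integral_of_forall_compl_eq_zero (s := Icc (-b) b)]
  · refine integral_congr_ae ?_
    filter_upwards [Lp.coeFn_sub hF'.toLp (h.sum fun i c => c • v i), hF'.coeFn_toLp,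
      Lp_coeFn_sum h.support (fun i => h i • v i), ae_all_iff.2 fun l => (hv l).coeFn_toLp,
      ae_all_iff.2 fun l => Lp.coeFn_smul (h l) (v l)] with ν e1 e2 e3 e4 e5
    rw [e1, Pi.sub_apply, e2, Finsupp.sum, e3, firTransfer_mul_eq]
    congr 3
    refine Finset.sum_congr rfl fun l _ => ?_
    rw [e5, Pi.smul_apply, e4, smul_eq_mul]
  · intro ν hν
    rw [hF.eq_zero ν hν, hG.eq_zero ν hν]
    simp

/-! ### Uniqueness of the spectral density -/

section SpectralDensity

variable {Ω : Type*} [MeasurableSpace Ω] {μ : Measure Ω} {a : ℤ → Ω → ℝ}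

/-- Two densities have the same Fourier coefficients. This allows the chosen `spectralDensity` to be
replaced by an explicit one inside integrals. -/
theorem IsSpectralDensity.ae_eq {x : ℤ → Lp ℂ 2 μ} {S S' : ℝ → ℝ} (hS : IsSpectralDensity x S)
    (hS' : IsSpectralDensity x S') :
    ∀ᵐ ν ∂volume.restrict (Ioc (-(1 / 2) : ℝ) (1 / 2)), S ν = S' ν := by
  have hab : (-(1 / 2) : ℝ) ≤ 1 / 2 := by norm_num
  have i1 := (intervalIntegrable_iff_integrableOn_Icc_of_le hab).1 hS.integrable
  have i2 := (intervalIntegrable_iff_integrableOn_Icc_of_le hab).1 hS'.integrable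
  have key := ae_eq_zero_of_integral_exp_eq_zero (b := 1 / 2) (Te := 1) one_pos (by norm_num)
    (D := (Icc (-(1 / 2) : ℝ) (1 / 2)).indicator fun ν => ((S ν - S' ν : ℝ) : ℂ))
    ((integrable_indicator_iff measurableSet_Icc).2 (i1.sub i2).ofReal)
    (fun ν hν => indicator_of_notMem hν _) (fun l => by
      rw [← setIntegral_eq_integral_of_forall_compl_eq_zero (s := Icc (-(1 / 2) : ℝ) (1 / 2))
        fun ν hν => by rw [indicator_of_notMem hν, mul_zero]]
      have e : ∀ ν ∈ Icc (-(1 / 2) : ℝ) (1 / 2),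
          Complex.exp (2 * Real.pi * Complex.I * l * ((1 : ℝ) * ν)) *
            (Icc (-(1 / 2) : ℝ) (1 / 2)).indicator (fun ν => ((S ν - S' ν : ℝ) : ℂ)) ν =
          (S ν : ℂ) * Complex.exp (2 * Real.pi * Complex.I * l * ν) -
            (S' ν : ℂ) * Complex.exp (2 * Real.pi * Complex.I * l * ν) := fun ν hν => by
        rw [indicator_of_mem hν]; push_cast; rw [one_mul]; ring
      have hm : ∀ {R : ℝ → ℝ}, IntegrableOn R (Icc (-(1 / 2) : ℝ) (1 / 2)) →
          IntegrableOn (fun ν : ℝ => (R ν : ℂ) * Complex.exp (2 * Real.pi * Complex.I * l * ν))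
            (Icc (-(1 / 2) : ℝ) (1 / 2)) := fun hR => by
        refine (integrable_exp_mul hR.ofReal l).congr (.of_forall fun ν => ?_)
        simp only [RCLike.ofReal_eq_complex_ofReal]
        rw [mul_comm, mul_right_comm (2 * Real.pi * Complex.I : ℂ)]
        push_cast
        rfl
      rw [setIntegral_congr_fun measurableSet_Icc e, integral_sub (hm i1) (hm i2),
        integral_Icc_eq_integral_Ioc, integral_Icc_eq_integral_Ioc,
        ← intervalIntegral.integral_of_le hab, ← intervalIntegral.integral_of_le hab,
        ← hS.corr, ← hS'.corr, sub_self])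
  rw [restrict_Ioc_eq_restrict_Icc]
  filter_upwards [ae_restrict_of_ae key, ae_restrict_mem measurableSet_Icc] with ν h1 h2
  rw [indicator_of_mem h2] at h1
  exact sub_eq_zero.1 (by exact_mod_cast h1)

theorem IsSpectralDensity.spectralDensity {x : ℤ → Lp ℂ 2 μ} {S : ℝ → ℝ}
    (hS : IsSpectralDensity x S) : IsSpectralDensity x (spectralDensity x) := by
  have h : ∃ S, IsSpectralDensity x S := ⟨S, hS⟩
  rw [BPSK.spectralDensity, dif_pos h]
  exact h.choose_spec

end SpectralDensity

/-! ### Filterings of the sampled signal -/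

theorem intervalIntegral_comp_div {E : Type*} [NormedAddCommGroup E] [NormedSpace ℝ E] {b Te : ℝ}
    (hTe : 0 < Te) (hb : b * Te ≤ 1 / 2) {φ : ℝ → E} (hφ : ∀ ν, ν ∉ Icc (-b) b → φ ν = 0) :
    ∫ ν in (-(1 / 2) : ℝ)..(1 / 2), φ (ν / Te) = Te • ∫ ν, φ ν := by
  rw [← integral_eq_intervalIntegral_of_eq_zero (F := fun ν => φ (ν / Te)) (by norm_num),
    Measure.integral_comp_div φ Te, abs_of_pos hTe]
  intro ν hν
  refine hφ _ fun h => hν ⟨?_, ?_⟩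
  · have := (le_div_iff₀ hTe).1 h.1; linarith
  · have := (div_le_iff₀ hTe).1 h.2; linarith

/-- Bandwidth `b`, symbol period `T` and sampling period `Te` for which the sampled signal is
analysed. -/
structure IsSampling (b T Te : ℝ) : Prop where
  b_pos : 0 < b
  T_pos : 0 < T
  Te_pos : 0 < Te
  excess : 2 * b * T ≤ 2
  shannon : b * Te ≤ 1 / 2
  generic : IsGenericRate (Te / T)

section Filters

variable {Ω : Type*} [MeasurableSpace Ω] {μ : Measure Ω} [IsProbabilityMeasure μ] {a : ℤ → Ω → ℝ}
variable {b T Te : ℝ} {F G : ℝ → ℂ}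

/-- The spectral density of the sampled signal whose pulse has spectrum `G`. -/
def pulseDensity (T Te : ℝ) (G : ℝ → ℂ) (ν : ℝ) : ℝ := ‖G (ν / Te)‖ ^ 2 / (T * Te)

theorem IsSpectrum.integrable_normSq (hG : IsSpectrum b G) : Integrable fun ν => ‖G ν‖ ^ 2 :=
  hG.memLp.integrable_norm_pow (by norm_num)

/-- The averaged correlation is `T⁻¹ ∫ f(u + m * Te) * conj (f u)`. Plancherel and the substitution
`ν ↦ ν / Te`, with no folding by Shannon's condition, turn it into a Fourier coefficient of the
density. -/
theorem IsBPSK.isSpectralDensity_pulseDensity (ha : IsBPSK μ a) (hs : IsSampling b T Te)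
    (hG : IsSpectrum b G) : IsSpectralDensity (pulseSignal ha T Te G) (pulseDensity T Te G) := by
  have hT := hs.T_pos
  have hTe := hs.Te_pos
  have ht : ∀ m : ℤ, Tendsto (partialAvg (cyclicCorrSeq (pulseSignal ha T Te G) 0 m)) atTop
      (𝓝 (latticeCoeff T (fun u => invFT G (u + m * Te) * conj (invFT G u)) 0)) := fun m => by
    have := ha.tendsto_cyclicCorrSeq hs.b_pos hs.T_pos hs.excess hG hs.generic (l := 0) (by simp) m
    simpa using this
  refine ⟨fun ν => ?_, ?_, fun m => ⟨_, ht m⟩, fun m => ?_⟩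
  · rw [pulseDensity]; positivity
  · exact ((hG.integrable_normSq.comp_div hTe.ne').div_const _).intervalIntegrable
  · rw [cyclicCorr, timeAvg_eq_of_tendsto (ht m), latticeCoeff]
    have e1 : ∫ u : ℝ, invFT G (u + m * Te) * conj (invFT G u) *
        Complex.exp (-(2 * Real.pi * Complex.I * ((0 : ℤ) : ℂ) * (u / T))) =
        ∫ ν : ℝ, Complex.exp (2 * Real.pi * Complex.I * ν * ((m * Te : ℝ) : ℂ)) * G ν * conj (G ν) := by
      rw [← (hG.exp_mul (m * Te)).plancherel hs.b_pos hG]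
      simp only [invFT_exp_mul]
      simp
    have e2 := intervalIntegral_comp_div hTe hs.shannon (φ := fun ν => ((‖G ν‖ ^ 2 / (T * Te) : ℝ) : ℂ) *
        Complex.exp (2 * Real.pi * Complex.I * m * ((ν * Te : ℝ) : ℂ)))
        (fun ν hν => by simp [hG.eq_zero ν hν])
    have e3 : ∀ ν : ℝ, (ν / Te) * Te = ν := fun ν => by field_simp
    simp only [e3] at e2
    have hT' : (T : ℂ) ≠ 0 := by exact_mod_cast hT.ne'
    have hTe' : (Te : ℂ) ≠ 0 := by exact_mod_cast hTe.ne'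
    simp only [pulseDensity]
    rw [e1, e2, Complex.real_smul, ← integral_const_mul, ← integral_const_mul]
    congr 1 with ν
    rw [mul_assoc (Complex.exp _), Complex.mul_conj']
    push_cast
    rw [show (2 * Real.pi * Complex.I * ν * (m * Te) : ℂ) = 2 * Real.pi * Complex.I * m * (ν * Te) by
      ring]
    field_simp

theorem IsBPSK.spectralDensity_ae_eq (ha : IsBPSK μ a) (hs : IsSampling b T Te)
    (hG : IsSpectrum b G) : ∀ᵐ ν ∂volume.restrict (Ioc (-(1 / 2) : ℝ) (1 / 2)),
      spectralDensity (pulseSignal ha T Te G) ν = pulseDensity T Te G ν :=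
  (ha.isSpectralDensity_pulseDensity hs hG).spectralDensity.ae_eq
    (ha.isSpectralDensity_pulseDensity hs hG)

/-- Identifies the filter norm with the L² norm of the filtered pulse spectrum, up to the factor
`T⁻¹`. -/
theorem IsBPSK.filterNormSq_pulseSignal (ha : IsBPSK μ a) (hs : IsSampling b T Te)
    (hG : IsSpectrum b G) (f : ℝ → ℂ) :
    filterNormSq (pulseSignal ha T Te G) f = T⁻¹ * ∫ ν, ‖G ν * f (Te * ν)‖ ^ 2 := by
  have hT := hs.T_pos
  have hTe := hs.Te_pos
  have e := intervalIntegral_comp_div hTe hs.shannon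
    (φ := fun ν => ‖f (Te * ν)‖ ^ 2 * (‖G ν‖ ^ 2 / (T * Te)))
    (fun ν hν => by simp [hG.eq_zero ν hν])
  have e3 : ∀ ν : ℝ, Te * (ν / Te) = ν := fun ν => by field_simp
  simp only [e3] at e
  rw [filterNormSq]
  have e4 : ∫ ν in (-(1 / 2) : ℝ)..(1 / 2), ‖f ν‖ ^ 2 * spectralDensity (pulseSignal ha T Te G) ν =
      ∫ ν in (-(1 / 2) : ℝ)..(1 / 2), ‖f ν‖ ^ 2 * (‖G (ν / Te)‖ ^ 2 / (T * Te)) := by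
    rw [intervalIntegral.integral_of_le (by norm_num), intervalIntegral.integral_of_le (by norm_num)]
    refine integral_congr_ae ?_
    filter_upwards [ha.spectralDensity_ae_eq hs hG] with ν hν
    rw [hν, pulseDensity]
  rw [e4, e, smul_eq_mul, ← integral_const_mul, ← integral_const_mul]
  congr 1 with ν
  rw [norm_mul]
  field_simp

theorem IsBPSK.finiteFilterNorm_iff (ha : IsBPSK μ a) (hs : IsSampling b T Te)
    (hG : IsSpectrum b G) {f : ℝ → ℂ} (hf : Measurable f) :
    FiniteFilterNorm (pulseSignal ha T Te G) f ↔ IsSpectrum b fun ν => G ν * f (Te * ν) := by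
  have hT := hs.T_pos
  have hTe := hs.Te_pos
  have hab : (-(1 / 2) : ℝ) ≤ 1 / 2 := by norm_num
  have hm : AEStronglyMeasurable (fun ν => G ν * f (Te * ν)) volume :=
    hG.memLp.1.mul (hf.comp (measurable_const_mul Te)).aestronglyMeasurable
  have e1 : FiniteFilterNorm (pulseSignal ha T Te G) f ↔
      IntegrableOn (fun ν => ‖G (ν / Te) * f ν‖ ^ 2 / (T * Te)) (Icc (-(1 / 2)) (1 / 2)) := by
    rw [FiniteFilterNorm, and_iff_right hf, intervalIntegrable_iff_integrableOn_Icc_of_le hab,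
      IntegrableOn, IntegrableOn, ← restrict_Ioc_eq_restrict_Icc]
    refine integrable_congr ?_
    filter_upwards [ha.spectralDensity_ae_eq hs hG] with ν hν
    rw [hν, pulseDensity, norm_mul]
    ring
  have e2 : IntegrableOn (fun ν => ‖G (ν / Te) * f ν‖ ^ 2 / (T * Te)) (Icc (-(1 / 2)) (1 / 2)) ↔
      Integrable (fun ν => ‖G (ν / Te) * f ν‖ ^ 2 / (T * Te)) := by
    refine integrableOn_iff_integrable_of_support_subset fun ν hν => ?_
    by_contra h
    refine hν ?_
    simp only
    rw [hG.eq_zero, zero_mul, norm_zero]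
    · simp
    · intro h'
      refine h ⟨?_, ?_⟩
      · have := (le_div_iff₀ hTe).1 h'.1; linarith [hs.shannon]
      · have := (div_le_iff₀ hTe).1 h'.2; linarith [hs.shannon]
  have e3 : Integrable (fun ν => ‖G (ν / Te) * f ν‖ ^ 2 / (T * Te)) ↔
      Integrable (fun ν => ‖G ν * f (Te * ν)‖ ^ 2) := by
    rw [← integrable_comp_mul_left_iff _ hTe.ne']
    have : (fun ν => ‖G (Te * ν / Te) * f (Te * ν)‖ ^ 2 / (T * Te)) =
        fun ν => ‖G ν * f (Te * ν)‖ ^ 2 * (T * Te)⁻¹ := by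
      ext ν
      rw [mul_div_cancel_left₀ _ hTe.ne', div_eq_mul_inv]
    rw [this]
    exact integrable_mul_const_iff (isUnit_iff_ne_zero.2 (by positivity)) _
  rw [e1, e2, e3, ← memLp_two_iff_integrable_sq_norm hm]
  exact ⟨fun h => ⟨h, fun ν hν => by rw [hG.eq_zero ν hν, zero_mul]⟩, fun h => h.memLp⟩

theorem IsSpectrum.energy_invFT (hb : 0 < b) (hF : IsSpectrum b F) :
    energy (invFT F) = ∫ ν, ‖F ν‖ ^ 2 := by
  have h := hF.plancherel hb hF
  simp only [Complex.mul_conj', ← Complex.ofReal_pow, integral_complex_ofReal] at h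
  exact_mod_cast h

/-- Only the three harmonics -1, 0, 1 occur, each of modulus at most `T⁻¹` times the energy. -/
theorem IsSpectrum.tsum_normSq_le (hb : 0 < b) (hT : 0 < T) (hbT : 2 * b * T ≤ 2)
    (hF : IsSpectrum b F) (t : ℝ) :
    ∑' j : ℤ, ‖invFT F (t - j * T)‖ ^ 2 ≤ 3 * T⁻¹ * ∫ ν, ‖F ν‖ ^ 2 := by
  have h := hF.hasSum_lattice hb hT (K := 1) (by norm_num; exact hbT) hF t
  have h' := Complex.hasSum_ofReal.2 (hF.summable_normSq_lattice hb hT t).hasSum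
  simp only [Complex.ofReal_pow, ← Complex.mul_conj'] at h'
  have e := congrArg norm (h'.unique h)
  rw [Complex.norm_real, Real.norm_of_nonneg (tsum_nonneg fun _ => by positivity)] at e
  rw [e]
  have hc : ∀ m : ℤ, ‖latticeCoeff T (fun u => invFT F u * conj (invFT F u)) m *
      Complex.exp (2 * Real.pi * Complex.I * m * (t / T))‖ ≤ T⁻¹ * ∫ ν, ‖F ν‖ ^ 2 := by
    intro m
    have h1 : ‖Complex.exp (2 * Real.pi * Complex.I * m * (t / T))‖ = 1 := by
      simpa using norm_exp_two_pi m (t / T)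
    rw [norm_mul, h1, mul_one, norm_latticeCoeff hT, div_eq_inv_mul, ← hF.energy_invFT hb]
    gcongr
    refine (norm_integral_le_integral_norm _).trans (le_of_eq ?_)
    congr 1 with u
    have h2 : ‖Complex.exp (-(2 * Real.pi * Complex.I * m * (u / T)))‖ = 1 := by
      have := norm_exp_two_pi (-m) (u / T)
      simpa using this
    rw [norm_mul, h2, mul_one, norm_mul, RCLike.norm_conj, pow_two]
  refine (norm_sum_le _ _).trans ((Finset.sum_le_card_nsmul _ _ _ fun m _ => hc m).trans
    (le_of_eq ?_))
  simp
  ring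

theorem invFT_sub {F H : ℝ → ℂ} (hF : Integrable F) (hH : Integrable H) (t : ℝ) :
    invFT (fun ν => F ν - H ν) t = invFT F t - invFT H t := by
  simp only [invFT, mul_sub]
  exact integral_sub (integrable_exp_mul hF t) (integrable_exp_mul hH t)

theorem IsSpectrum.sub {F H : ℝ → ℂ} (hF : IsSpectrum b F) (hH : IsSpectrum b H) :
    IsSpectrum b fun ν => F ν - H ν where
  memLp := hF.memLp.sub hH.memLp
  eq_zero ν hν := by rw [hF.eq_zero ν hν, hH.eq_zero ν hν, sub_zero]

/-- Continuity from pulse spectra to signals, uniform in `n`: convergence in filter norm forces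
convergence of the outputs in mean square. -/
theorem IsBPSK.norm_pulseSignal_sub_sq_le (ha : IsBPSK μ a) (hb : 0 < b) (hT : 0 < T)
    (hbT : 2 * b * T ≤ 2) {F H : ℝ → ℂ} (hF : IsSpectrum b F) (hH : IsSpectrum b H) (n : ℤ) :
    ‖pulseSignal ha T Te F n - pulseSignal ha T Te H n‖ ^ 2 ≤
      3 * T⁻¹ * ∫ ν, ‖F ν - H ν‖ ^ 2 := by
  refine le_trans (le_of_eq ?_) ((hF.sub hH).tsum_normSq_le hb hT hbT (n * Te))
  rw [(ha.hasSum_norm_sq_symbolSeries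
    ((hF.sub hH).summable_normSq_lattice hb hT (n * Te))).tsum_eq, pulseSignal, pulseSignal,
    ← ha.symbolSeries_sub (hF.summable_normSq_lattice hb hT _)
      (hH.summable_normSq_lattice hb hT _)]
  simp only [invFT_sub hF.integrable hH.integrable]

theorem invFT_firTransfer {F : ℝ → ℂ} (hF : Integrable F) (h : ℤ →₀ ℂ) (Te t : ℝ) :
    invFT (fun ν => F ν * firTransfer h (Te * ν)) t =
      ∑ l ∈ h.support, h l * invFT F (t - l * Te) := by
  simp only [firTransfer_mul_eq, sub_eq_add_neg t, ← invFT_exp_mul]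
  simp only [invFT, Finset.mul_sum]
  rw [integral_finsetSum]
  · refine Finset.sum_congr rfl fun l _ => ?_
    rw [← integral_const_mul]
    congr 1 with ν
    ring
  · intro l _
    refine ((integrable_exp_mul (integrable_exp_mul hF (-(l * Te))) t).const_mul (h l)).congr
      (.of_forall fun ν => ?_)
    ring

theorem firTransfer_bounded (h : ℤ →₀ ℂ) (ν : ℝ) : ‖firTransfer h ν‖ ≤ ∑ l ∈ h.support, ‖h l‖ := by
  refine (norm_sum_le _ _).trans (Finset.sum_le_sum fun l _ => ?_)
  have := norm_exp_two_pi (-l) ν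
  rw [norm_mul]
  simp at this
  simp [this]

theorem continuous_firTransfer (h : ℤ →₀ ℂ) : Continuous (firTransfer h) := by
  unfold firTransfer Finsupp.sum
  fun_prop

theorem IsSpectrum.mul_firTransfer (hF : IsSpectrum b F) (h : ℤ →₀ ℂ) (Te : ℝ) :
    IsSpectrum b fun ν => F ν * firTransfer h (Te * ν) where
  memLp := by
    have hc := continuous_firTransfer h
    refine hF.memLp.of_le_mul (c := ∑ l ∈ h.support, ‖h l‖) (hF.memLp.1.mul
      (by fun_prop : Continuous fun ν => firTransfer h (Te * ν)).aestronglyMeasurable)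
      (.of_forall fun ν => ?_)
    rw [norm_mul, mul_comm]
    exact mul_le_mul_of_nonneg_right (firTransfer_bounded h _) (norm_nonneg _)
  eq_zero ν hν := by rw [hF.eq_zero ν hν, zero_mul]

theorem IsBPSK.firOutput_pulseSignal (ha : IsBPSK μ a) (hb : 0 < b) (hT : 0 < T)
    (hG : IsSpectrum b G) (h : ℤ →₀ ℂ) (n : ℤ) :
    firOutput h (pulseSignal ha T Te G) n =
      pulseSignal ha T Te (fun ν => G ν * firTransfer h (Te * ν)) n := by
  have h1 := hasSum_sum (s := h.support) fun l _ => (ha.hasSum_symbolSeries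
    (hG.summable_normSq_lattice hb hT (((n - l : ℤ) : ℝ) * Te))).const_smul (h l)
  have h2 := ha.hasSum_symbolSeries
    ((hG.mul_firTransfer h Te).summable_normSq_lattice hb hT (n * Te))
  refine h1.unique (hasSum_congr h2 (fun j => ?_) rfl)
  rw [invFT_firTransfer hG.integrable, Finset.sum_smul]
  refine Finset.sum_congr rfl fun l _ => ?_
  rw [mul_smul]
  congr 3
  push_cast
  ring

/-- The unit norm filterings of a sampled linear modulation are the sampled linear modulations
whose pulse is band-limited with energy `T`. -/
theorem IsBPSK.unitFiltered_pulseSignal (ha : IsBPSK μ a) (hs : IsSampling b T Te)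
    (hG : IsSpectrum b G) (hG0 : ∀ᵐ ν ∂volume.restrict (Icc (-b) b), G ν ≠ 0) :
    unitFiltered (pulseSignal ha T Te G) =
      {r | ∃ F, IsSpectrum b F ∧ ∫ ν, ‖F ν‖ ^ 2 = T ∧ r = pulseSignal ha T Te F} := by
  have hT := hs.T_pos
  have hTe := hs.Te_pos
  have hb := hs.b_pos
  ext r
  constructor
  · rintro ⟨f, hf1, hf, h, hh, hr⟩
    have hF := (ha.finiteFilterNorm_iff hs hG hf.1).1 hf
    refine ⟨_, hF, ?_, funext fun n => ?_⟩
    · rw [ha.filterNormSq_pulseSignal hs hG] at hf1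
      field_simp at hf1
      exact hf1
    -- The FIR outputs also converge to the signal with spectrum `G ν * f (Te * ν)`, so the output
    -- `r` does not depend on the approximating sequence.
    · refine tendsto_nhds_unique (hr n) ?_
      rw [tendsto_iff_norm_sub_tendsto_zero]
      have hsq : Tendsto (fun k => ‖firOutput (h k) (pulseSignal ha T Te G) n -
          pulseSignal ha T Te (fun ν => G ν * f (Te * ν)) n‖ ^ 2) atTop (𝓝 0) := by
        refine squeeze_zero (fun _ => by positivity) (fun k => ?_)
          (by simpa using hh.const_mul 3)
        rw [ha.firOutput_pulseSignal hb hT hG, norm_sub_rev]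
        refine (ha.norm_pulseSignal_sub_sq_le hb hT hs.excess hF
          (hG.mul_firTransfer (h k) Te) n).trans (le_of_eq ?_)
        rw [ha.filterNormSq_pulseSignal hs hG, mul_assoc]
        simp only [mul_sub]
      have := hsq.sqrt
      simpa using this
  · rintro ⟨F, hF, hF1, rfl⟩
    -- The required filter is the quotient `F / G`, rescaled in frequency. A transfer function has
    -- to be measurable, so measurable representatives are divided; their zeros and their values off
    -- the band do not matter.
    obtain ⟨F', hF'm, hF'⟩ := hF.memLp.1
    obtain ⟨G', hG'm, hG'⟩ := hG.memLp.1
    set f : ℝ → ℂ := fun ν => F' (ν / Te) / G' (ν / Te) with hf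
    have hfm : Measurable f := (hF'm.measurable.comp (measurable_id.div_const Te)).div
      (hG'm.measurable.comp (measurable_id.div_const Te))
    have hFG : ∀ᵐ ν, G ν * f (Te * ν) = F ν := by
      filter_upwards [hF', hG', (ae_restrict_iff' measurableSet_Icc).1 hG0] with ν h1 h2 h3
      by_cases hν : ν ∈ Icc (-b) b
      · simp only [hf]
        rw [mul_div_cancel_left₀ _ hTe.ne', ← h1, ← h2]
        field_simp [h3 hν]
      · rw [hG.eq_zero ν hν, hF.eq_zero ν hν, zero_mul]
    have hfin : FiniteFilterNorm (pulseSignal ha T Te G) f := by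
      rw [ha.finiteFilterNorm_iff hs hG hfm]
      refine ⟨hF.memLp.ae_eq ?_, fun ν hν => by rw [hG.eq_zero ν hν, zero_mul]⟩
      filter_upwards [hFG] with ν h using h.symm
    refine ⟨f, ?_, hfin, ?_⟩
    · rw [ha.filterNormSq_pulseSignal hs hG]
      have : ∫ ν, ‖G ν * f (Te * ν)‖ ^ 2 = ∫ ν, ‖F ν‖ ^ 2 := by
        refine integral_congr_ae ?_
        filter_upwards [hFG] with ν h
        rw [h]
      rw [this, hF1, inv_mul_cancel₀ hT.ne']
    · choose h hh using fun k : ℕ => hF.exists_firTransfer_approx hTe hs.shannon hG hG0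
        (by positivity : (0 : ℝ) < 1 / ((k : ℝ) + 1))
      have hlim : Tendsto (fun k => ∫ ν, ‖F ν - G ν * firTransfer (h k) (Te * ν)‖ ^ 2) atTop
          (𝓝 0) :=
        squeeze_zero (fun _ => integral_nonneg fun _ => by positivity) (fun k => (hh k).le)
          tendsto_one_div_add_atTop_nhds_zero_nat
      refine ⟨h, ?_, fun n => ?_⟩
      · have e : ∀ k, filterNormSq (pulseSignal ha T Te G) (fun ν => f ν - firTransfer (h k) ν) =
            T⁻¹ * ∫ ν, ‖F ν - G ν * firTransfer (h k) (Te * ν)‖ ^ 2 := fun k => by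
          rw [ha.filterNormSq_pulseSignal hs hG]
          congr 1
          refine integral_congr_ae ?_
          filter_upwards [hFG] with ν h
          rw [mul_sub, h]
        simp only [e]
        simpa using hlim.const_mul T⁻¹
      · rw [tendsto_iff_norm_sub_tendsto_zero]
        have hsq : Tendsto (fun k => ‖firOutput (h k) (pulseSignal ha T Te G) n -
            pulseSignal ha T Te F n‖ ^ 2) atTop (𝓝 0) := by
          refine squeeze_zero (fun _ => by positivity) (fun k => ?_)
            (by simpa using hlim.const_mul (3 * T⁻¹))
          rw [ha.firOutput_pulseSignal hb hT hG, norm_sub_rev]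
          exact ha.norm_pulseSignal_sub_sq_le hb hT hs.excess hF (hG.mul_firTransfer (h k) Te) n
        have := hsq.sqrt
        simpa using this

end Filters

/-! Scaling -/

theorem energy_smul (c : ℝ) (f : ℝ → ℂ) : energy (fun t => (c : ℂ) * f t) = c ^ 2 * energy f := by
  simp only [energy]
  rw [← integral_const_mul]
  congr 1 with t
  rw [norm_mul, Complex.norm_real, mul_pow, Real.norm_eq_abs, sq_abs]

theorem Psi_smul {c : ℝ} (hc : c ≠ 0) (T : ℝ) (f : ℝ → ℂ) :
    Psi T (fun t => (c : ℂ) * f t) = Psi T f := by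
  have e : ∫ t, ‖(c : ℂ) * f t‖ ^ 4 = c ^ 4 * ∫ t, ‖f t‖ ^ 4 := by
    rw [← integral_const_mul]
    congr 1 with t
    rw [norm_mul, Complex.norm_real, mul_pow, Real.norm_eq_abs, Even.pow_abs (by decide)]
  rw [Psi, Psi, e, energy_smul]
  congr 1
  rw [mul_pow, ← pow_mul, mul_div_mul_left _ _ (pow_ne_zero _ hc)]

theorem PhiPrime_smul {c : ℝ} (hc : c ≠ 0) (T : ℝ) (f : ℝ → ℂ) :
    PhiPrime T (fun t => (c : ℂ) * f t) = PhiPrime T f := by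
  have hc' : (c : ℂ) ≠ 0 := by exact_mod_cast hc
  have e1 : ∫ t : ℝ, ((‖(c : ℂ) * f t‖ ^ 2 : ℝ) : ℂ) *
        Complex.exp (-(2 * Real.pi * Complex.I * (t / T))) =
      (c : ℂ) ^ 2 * ∫ t : ℝ, ((‖f t‖ ^ 2 : ℝ) : ℂ) *
        Complex.exp (-(2 * Real.pi * Complex.I * (t / T))) := by
    rw [← integral_const_mul]
    congr 1 with t
    rw [norm_mul, Complex.norm_real, mul_pow, Real.norm_eq_abs, sq_abs]
    push_cast
    ring
  have e2 : ∀ E : ℝ → ℂ, ∫ t : ℝ, ((c : ℂ) * f t) ^ 2 * E t = (c : ℂ) ^ 2 * ∫ t : ℝ, f t ^ 2 * E t := by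
    intro E
    rw [← integral_const_mul]
    congr 1 with t
    ring
  have e3 : ∀ z : ℂ, ‖(c : ℂ) ^ 2 * z‖ ^ 2 / (c ^ 2 * energy f) ^ 2 = ‖z‖ ^ 2 / energy f ^ 2 := by
    intro z
    rw [norm_mul, norm_pow, Complex.norm_real, Real.norm_eq_abs, sq_abs, mul_pow, mul_pow,
      mul_div_mul_left _ _ (by positivity)]
  rw [PhiPrime, PhiPrime, Psi_smul hc, energy_smul, e1, e2, e2, e3, e3]
  congr 5
  push_cast
  rw [mul_div_mul_left _ _ (pow_ne_zero _ hc')]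

theorem invFT_const_mul (c : ℂ) (F : ℝ → ℂ) : invFT (fun ν => c * F ν) = fun t => c * invFT F t := by
  ext t
  rw [invFT, invFT, ← integral_const_mul]
  congr 1 with ν
  ring

theorem IsSpectrum.const_mul {b : ℝ} {F : ℝ → ℂ} (c : ℂ) (hF : IsSpectrum b F) :
    IsSpectrum b fun ν => c * F ν where
  memLp := hF.memLp.const_mul c
  eq_zero ν hν := by rw [hF.eq_zero ν hν, mul_zero]

theorem HasSpectrumIn.isSpectrum {b : ℝ} {f F : ℝ → ℂ} (h : HasSpectrumIn (Icc (-b) b) f F) :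
    IsSpectrum b F := ⟨h.memLp, h.eq_zero⟩

theorem HasSpectrumIn.eq_invFT {b : ℝ} {f F : ℝ → ℂ} (h : HasSpectrumIn (Icc (-b) b) f F) :
    f = invFT F := by
  ext t
  rw [h.inversion, invFT]
  exact setIntegral_eq_integral_of_forall_compl_eq_zero fun ν hν => by
    rw [h.eq_zero ν hν, mul_zero]

theorem IsSpectrum.invFT_mem_bandLimited {b : ℝ} (hb : 0 < b) {F : ℝ → ℂ} (hF : IsSpectrum b F) :
    invFT F ∈ bandLimited (Icc (-b) b) := by
  refine ⟨hF.memLp_invFT hb, F, hF.memLp, hF.eq_zero, fun t => ?_⟩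
  rw [invFT]
  exact (setIntegral_eq_integral_of_forall_compl_eq_zero fun ν hν => by
    rw [hF.eq_zero ν hν, mul_zero]).symm

theorem bandLimited_mono {B B' : Set ℝ} (h : B ⊆ B') : bandLimited B ⊆ bandLimited B' := by
  rintro f ⟨hf, F, hF⟩
  refine ⟨hf, F, hF.memLp, fun ν hν => hF.eq_zero ν fun h' => hν (h h'), fun t => ?_⟩
  rw [hF.inversion, setIntegral_eq_integral_of_forall_compl_eq_zero,
    setIntegral_eq_integral_of_forall_compl_eq_zero]
  · intro ν hν
    rw [hF.eq_zero ν fun h' => hν (h h'), mul_zero]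
  · intro ν hν
    rw [hF.eq_zero ν hν, mul_zero]

theorem IsSpectrum.integral_normSq_pos {b : ℝ} {F : ℝ → ℂ} (hF : IsSpectrum b F)
    (h : invFT F ≠ 0) : 0 < ∫ ν, ‖F ν‖ ^ 2 := by
  refine lt_of_le_of_ne (integral_nonneg fun _ => by positivity) fun h0 => h ?_
  have h1 := (integral_eq_zero_iff_of_nonneg (fun _ => by positivity) hF.integrable_normSq).1 h0.symm
  ext t
  rw [invFT, Pi.zero_apply]
  refine integral_eq_zero_of_ae ?_
  filter_upwards [h1] with ν hν
  have : F ν = 0 := by simpa using hν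
  rw [this, mul_zero, Pi.zero_apply]

/-- Functionals that do not depend on the scale take the same values on all nonzero band-limited
functions as on those of energy `T`. -/
theorem image_bandLimited_eq {b T : ℝ} (hb : 0 < b) (hT : 0 < T) {Φ : (ℝ → ℂ) → ℝ}
    (hΦ : ∀ (c : ℝ), c ≠ 0 → ∀ f : ℝ → ℂ, Φ (fun t => (c : ℂ) * f t) = Φ f) :
    Φ '' (bandLimited (Icc (-b) b) \ {0}) =
      {y | ∃ F, IsSpectrum b F ∧ ∫ ν, ‖F ν‖ ^ 2 = T ∧ y = Φ (invFT F)} := by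
  ext y
  constructor
  · rintro ⟨f, ⟨⟨-, F, hFf⟩, hf0⟩, rfl⟩
    have hF := hFf.isSpectrum
    rw [hFf.eq_invFT] at hf0 ⊢
    have hE := hF.integral_normSq_pos hf0
    -- The factor that brings the energy to `T`.
    have hc : 0 < Real.sqrt (T / ∫ ν, ‖F ν‖ ^ 2) := Real.sqrt_pos.2 (by positivity)
    refine ⟨_, hF.const_mul (Real.sqrt (T / ∫ ν, ‖F ν‖ ^ 2) : ℝ), ?_, ?_⟩
    · simp only [norm_mul, mul_pow, Complex.norm_real]
      rw [integral_const_mul, Real.norm_eq_abs, sq_abs, Real.sq_sqrt (by positivity)]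
      field_simp
    · rw [invFT_const_mul, hΦ _ hc.ne']
  · rintro ⟨F, hF, hE, rfl⟩
    refine ⟨_, ⟨hF.invFT_mem_bandLimited hb, fun h0 => ?_⟩, rfl⟩
    rw [mem_singleton_iff] at h0
    have := hF.energy_invFT hb
    rw [hE, h0] at this
    simp [energy] at this
    exact hT.ne this

/-! ### Lower bounds for the functionals -/

theorem IsSpectrum.normSq_invFT_le {b T : ℝ} (hb : 0 < b) (hT : 0 < T) (hbT : 2 * b * T ≤ 2)
    {F : ℝ → ℂ} (hF : IsSpectrum b F) (t : ℝ) :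
    ‖invFT F t‖ ^ 2 ≤ 3 * T⁻¹ * ∫ ν, ‖F ν‖ ^ 2 := by
  refine le_trans ?_ (hF.tsum_normSq_le hb hT hbT t)
  have := (hF.summable_normSq_lattice hb hT t).le_tsum 0 fun _ _ => by positivity
  simpa using this

/-- At energy `T` the pointwise bound reads `|f|² ≤ 3`, so `∫ |f|⁴ ≤ 3 * T`; multiplication by `κ =
-2` gives `-6`. -/
theorem IsSpectrum.neg_six_le_Psi {b T : ℝ} (hb : 0 < b) (hT : 0 < T) (hbT : 2 * b * T ≤ 2)
    {F : ℝ → ℂ} (hF : IsSpectrum b F) (hE : ∫ ν, ‖F ν‖ ^ 2 = T) : -6 ≤ Psi T (invFT F) := by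
  have hE' : energy (invFT F) = T := by rw [hF.energy_invFT hb, hE]
  have h1 : ∫ t, ‖invFT F t‖ ^ 4 ≤ 3 * T := by
    rw [← hE', energy, ← integral_const_mul]
    refine integral_mono_of_nonneg (.of_forall fun t => by positivity)
      (((hF.memLp_invFT hb).integrable_norm_pow (by norm_num)).const_mul 3)
      (.of_forall fun t => ?_)
    have := hF.normSq_invFT_le hb hT hbT t
    rw [hE, mul_assoc, inv_mul_cancel₀ hT.ne', mul_one] at this
    simp only
    nlinarith [sq_nonneg ‖invFT F t‖]
  rw [Psi, hE', kappa]
  have h2 : T * ((∫ t, ‖invFT F t‖ ^ 4) / T ^ 2) ≤ 3 := by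
    rw [← mul_div_assoc, div_le_iff₀ (by positivity)]
    nlinarith
  nlinarith

theorem Psi_add_two_le_PhiPrime (T : ℝ) (f : ℝ → ℂ) : Psi T f + 2 ≤ PhiPrime T f := by
  rw [PhiPrime, add_assoc, add_assoc]
  exact le_add_of_nonneg_right (by positivity)

/-! Small bandwidth -/

/-- By Plancherel this is the inner product of `F` with a translate of `H`, and their supports share
at most an endpoint. -/
theorem IsSpectrum.integral_mul_conj_exp_eq_zero {b c : ℝ} (hb : 0 < b) (hc : 2 * b ≤ |c|)
    {F H : ℝ → ℂ} (hF : IsSpectrum b F) (hH : IsSpectrum b H) :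
    ∫ t : ℝ, invFT F t * conj (invFT H t) *
      Complex.exp (-(2 * Real.pi * Complex.I * c * t)) = 0 := by
  have h := (hF.mono (le_add_of_nonneg_right (abs_nonneg c))).plancherel (by positivity)
    (hH.shift c)
  have e : ∀ t : ℝ, invFT F t * conj (invFT (fun ν => H (ν - c)) t) =
      invFT F t * conj (invFT H t) * Complex.exp (-(2 * Real.pi * Complex.I * c * t)) := by
    intro t
    rw [invFT_shift, map_mul, conj_exp_two_pi]
    ring
  simp only [e] at h
  rw [h]
  refine integral_eq_zero_of_ae ?_
  -- When `|c| = 2 * b` the supports do meet, at `b` or `-b`. This case cannot be avoided: at `γ =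
  -- 0` the shift `1/T` equals `2 * b`.
  have h0 : ∀ᵐ ν : ℝ, ν ∉ ({b, -b} : Set ℝ) :=
    measure_eq_zero_iff_ae_notMem.1 ((toFinite _).measure_zero _)
  filter_upwards [h0] with ν hν
  rw [Pi.zero_apply, mul_eq_zero]
  by_contra! h'
  have h1 : ν ∈ Icc (-b) b := by by_contra h1; exact h'.1 (hF.eq_zero _ h1)
  have h2 : ν - c ∈ Icc (-b) b := by
    by_contra h2; exact h'.2 (by rw [hH.eq_zero _ h2, map_zero])
  refine hν ?_
  rw [mem_insert_iff, mem_singleton_iff]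
  rcases le_abs.1 hc with h3 | h3
  · left; linarith [h1.1, h1.2, h2.1, h2.2]
  · right; linarith [h1.1, h1.2, h2.1, h2.2]

theorem IsSpectrum.PhiPrime_eq_of_le {b T : ℝ} (hb : 0 < b) (hT : 0 < T) (hbT : 2 * b * T ≤ 1)
    {F : ℝ → ℂ} (hF : IsSpectrum b F) : PhiPrime T (invFT F) = Psi T (invFT F) + 2 := by
  have hc : 2 * b ≤ T⁻¹ := by
    rw [← one_div, le_div_iff₀ hT]; exact hbT
  have h1 := hF.integral_mul_conj_exp_eq_zero (c := T⁻¹) hb (hc.trans (le_abs_self _)) hF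
  have h2 := hF.integral_mul_conj_exp_eq_zero (c := T⁻¹) hb (hc.trans (le_abs_self _)) hF.conj_neg
  have h3 := hF.integral_mul_conj_exp_eq_zero (c := -T⁻¹) hb
    (by rw [abs_neg]; exact hc.trans (le_abs_self _)) hF.conj_neg
  simp only [invFT_conj_neg, Complex.conj_conj, ← pow_two, Complex.mul_conj'] at h1 h2 h3
  have e1 : ∀ t : ℝ, (2 * Real.pi * Complex.I * ((T⁻¹ : ℝ) : ℂ) * t : ℂ) =
      2 * Real.pi * Complex.I * (t / T) := fun t => by push_cast; ring
  have e2 : ∀ t : ℝ, (-(2 * Real.pi * Complex.I * ((-T⁻¹ : ℝ) : ℂ) * t) : ℂ) =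
      2 * Real.pi * Complex.I * (t / T) := fun t => by push_cast; ring
  simp only [e1] at h1 h2
  simp only [e2] at h3
  rw [PhiPrime]
  push_cast
  rw [h1, h2, h3]
  simp

/-! ### Values over filters and values over band-limited functions -/

section Infima

variable {Ω : Type*} [MeasurableSpace Ω] {μ : Measure Ω} [IsProbabilityMeasure μ] {a : ℤ → Ω → ℝ}
variable {b T Te : ℝ} {G : ℝ → ℂ}

theorem IsBPSK.image_betaPrime_unitFiltered (ha : IsBPSK μ a) (hs : IsSampling b T Te)
    (hG : IsSpectrum b G) (hG0 : ∀ᵐ ν ∂volume.restrict (Icc (-b) b), G ν ≠ 0) :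
    betaPrime (Te / T) '' unitFiltered (pulseSignal ha T Te G) =
      PhiPrime T '' (bandLimited (Icc (-b) b) \ {0}) := by
  have key : ∀ F, IsSpectrum b F → ∫ ν, ‖F ν‖ ^ 2 = T →
      betaPrime (Te / T) (pulseSignal ha T Te F) = PhiPrime T (invFT F) := fun F hF hE =>
    ha.betaPrime_pulseSignal hs.b_pos hs.T_pos hs.excess hF hs.generic
      (by rw [hF.energy_invFT hs.b_pos, hE])
  rw [ha.unitFiltered_pulseSignal hs hG hG0,
    image_bandLimited_eq hs.b_pos hs.T_pos fun c hc f => PhiPrime_smul hc T f]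
  ext y
  constructor
  · rintro ⟨_, ⟨F, hF, hE, rfl⟩, rfl⟩
    exact ⟨F, hF, hE, key F hF hE⟩
  · rintro ⟨F, hF, hE, rfl⟩
    exact ⟨_, ⟨F, hF, hE, rfl⟩, key F hF hE⟩

theorem IsBPSK.image_avgCum4_unitFiltered (ha : IsBPSK μ a) (hs : IsSampling b T Te)
    (hG : IsSpectrum b G) (hG0 : ∀ᵐ ν ∂volume.restrict (Icc (-b) b), G ν ≠ 0) :
    avgCum4 '' unitFiltered (pulseSignal ha T Te G) =
      Psi T '' (bandLimited (Icc (-b) b) \ {0}) := by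
  have key : ∀ F, IsSpectrum b F → ∫ ν, ‖F ν‖ ^ 2 = T →
      avgCum4 (pulseSignal ha T Te F) = Psi T (invFT F) := fun F hF hE =>
    ha.avgCum4_pulseSignal hs.b_pos hs.T_pos hs.excess hF hs.generic
      (by rw [hF.energy_invFT hs.b_pos, hE])
  rw [ha.unitFiltered_pulseSignal hs hG hG0,
    image_bandLimited_eq hs.b_pos hs.T_pos fun c hc f => Psi_smul hc T f]
  ext y
  constructor
  · rintro ⟨_, ⟨F, hF, hE, rfl⟩, rfl⟩
    exact ⟨F, hF, hE, key F hF hE⟩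
  · rintro ⟨F, hF, hE, rfl⟩
    exact ⟨_, ⟨F, hF, hE, rfl⟩, key F hF hE⟩

/-- The shaping filter itself shows that the set of competitors is nonempty, as is needed for the
real infima to be greatest lower bounds. -/
theorem IsSpectrum.invFT_ne_zero (hb : 0 < b) (hG : IsSpectrum b G)
    (hG0 : ∀ᵐ ν ∂volume.restrict (Icc (-b) b), G ν ≠ 0) : invFT G ≠ 0 := by
  intro h
  have hE := hG.energy_invFT hb
  rw [h] at hE
  have h0 : ∫ ν, ‖G ν‖ ^ 2 = 0 := by rw [← hE]; simp [energy]
  have h1 := (integral_eq_zero_iff_of_nonneg (fun _ => by positivity) hG.integrable_normSq).1 h0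
  have h2 : ∀ᵐ ν ∂volume.restrict (Icc (-b) b), False := by
    filter_upwards [hG0, ae_restrict_of_ae h1] with ν h3 h4
    exact h3 (by simpa using h4)
  have h3 : volume.restrict (Icc (-b) b) = 0 := ae_eq_bot.1 (eventually_false_iff_eq_bot.1 h2)
  rw [Measure.restrict_eq_zero, Real.volume_Icc, ENNReal.ofReal_eq_zero] at h3
  linarith

theorem bandLimited_diff_nonempty (hb : 0 < b) (hG : IsSpectrum b G)
    (hG0 : ∀ᵐ ν ∂volume.restrict (Icc (-b) b), G ν ≠ 0) :
    (bandLimited (Icc (-b) b) \ {0}).Nonempty :=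
  ⟨_, hG.invFT_mem_bandLimited hb, hG.invFT_ne_zero hb hG0⟩

theorem neg_six_le_Psi (hb : 0 < b) (hT : 0 < T) (hbT : 2 * b * T ≤ 2) :
    -6 ∈ lowerBounds (Psi T '' (bandLimited (Icc (-b) b) \ {0})) := by
  rw [image_bandLimited_eq hb hT fun c hc f => Psi_smul hc T f]
  rintro _ ⟨F, hF, hE, rfl⟩
  exact hF.neg_six_le_Psi hb hT hbT hE

theorem bddBelow_Psi (hb : 0 < b) (hT : 0 < T) (hbT : 2 * b * T ≤ 2) :
    BddBelow (Psi T '' (bandLimited (Icc (-b) b) \ {0})) := ⟨-6, neg_six_le_Psi hb hT hbT⟩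

theorem bddBelow_PhiPrime (hb : 0 < b) (hT : 0 < T) (hbT : 2 * b * T ≤ 2) :
    BddBelow (PhiPrime T '' (bandLimited (Icc (-b) b) \ {0})) := by
  refine ⟨-6 + 2, ?_⟩
  rintro _ ⟨f, hf, rfl⟩
  exact (add_le_add_left (neg_six_le_Psi hb hT hbT ⟨f, hf, rfl⟩) 2).trans
    (Psi_add_two_le_PhiPrime T f)

end Infima

end BPSK

end

/-! ### The proposition -/

theorem mainTheorem7 {Ω : Type*} [MeasurableSpace Ω] (μ : Measure Ω) [IsProbabilityMeasure μ]
    (a : ℤ → Ω → ℝ) (ha : BPSK.IsBPSK μ a)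
    (T : ℝ) (hT : 0 < T)
    -- for each excess bandwidth `γ`: the sampling period and the shaping filter of the signal
    (Te : ℝ → ℝ) (g : ℝ → ℝ → ℂ)
    (hTe_pos : ∀ γ ∈ Ico (0 : ℝ) 1, 0 < Te γ)
    (hTe_shannon : ∀ γ ∈ Ico (0 : ℝ) 1, Te γ < T / (1 + γ))
    (hTe_generic : ∀ γ ∈ Ico (0 : ℝ) 1, Te γ ∉ ({T, T / 2, T / 3, 2 * T / 3} : Set ℝ))
    (hg : ∀ γ ∈ Ico (0 : ℝ) 1, BPSK.IsShapingFilter (BPSK.band T γ) (g γ))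
    (s : ℝ → ℤ → Lp ℂ 2 μ) (hs : ∀ γ, s γ = BPSK.sampled ha T (Te γ) (g γ))
    (βmin ηmin : ℝ → ℝ)
    (hβmin : ∀ γ, βmin γ = BPSK.betaPrimeMin (Te γ / T) (s γ))
    (hηmin : ∀ γ, ηmin γ = BPSK.etaMin (s γ)) :
    -- all the objects exist
    (∀ γ ∈ Ico (0 : ℝ) 1,
      (∀ t : ℝ, Summable fun n : ℤ => g γ (t - n * T) • BPSK.symbol ha n) ∧
      BPSK.IsSpectralDensity (s γ) (BPSK.spectralDensity (s γ)) ∧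
      (∀ r ∈ BPSK.unitFiltered (s γ), BPSK.BetaPrimeExists (Te γ / T) r) ∧
      IsGLB (BPSK.betaPrime (Te γ / T) '' BPSK.unitFiltered (s γ)) (βmin γ) ∧
      IsGLB (BPSK.avgCum4 '' BPSK.unitFiltered (s γ)) (ηmin γ)) ∧
    -- the expressions of the two infima over band-limited functions
    (∀ γ ∈ Ico (0 : ℝ) 1,
      IsGLB (BPSK.PhiPrime T '' (BPSK.bandLimited (BPSK.band T γ) \ {0})) (βmin γ) ∧
      IsGLB (BPSK.Psi T '' (BPSK.bandLimited (BPSK.band T γ) \ {0})) (ηmin γ)) ∧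
    -- monotonicity, the value at `0`, and the criterion
    AntitoneOn βmin (Ico (0 : ℝ) 1) ∧
    βmin 0 = ηmin 0 + 2 ∧
    ((∀ γ ∈ Ico (0 : ℝ) 1, βmin γ < 1 / 2) ↔ βmin 0 < 1 / 2) := by
  have hT2 : 0 < 2 * T := by positivity
  have hsamp : ∀ γ ∈ Ico (0 : ℝ) 1, BPSK.IsSampling ((1 + γ) / (2 * T)) T (Te γ) := by
    intro γ hγ
    have h0 := hTe_pos γ hγ
    have h1 := hTe_shannon γ hγ
    have h2 := hTe_generic γ hγ
    have hγ1 : 0 < 1 + γ := by linarith [hγ.1]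
    rw [lt_div_iff₀ hγ1] at h1
    have h3 : Te γ < T := by nlinarith [hγ.1]
    simp only [mem_insert_iff, mem_singleton_iff, not_or] at h2
    refine ⟨by positivity, hT, h0, ?_, ?_, ⟨by positivity, ?_, ?_, ?_, ?_⟩⟩
    · have : 2 * ((1 + γ) / (2 * T)) * T = 1 + γ := by field_simp
      linarith [hγ.2]
    · rw [div_mul_eq_mul_div, div_le_div_iff₀ hT2 two_pos]
      linarith
    · rwa [div_lt_one hT]
    · intro h; apply h2.2.1; rw [div_eq_iff hT.ne'] at h; linarith
    · intro h; apply h2.2.2.1; rw [div_eq_iff hT.ne'] at h; linarith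
    · intro h; apply h2.2.2.2; rw [div_eq_iff hT.ne'] at h; linarith
  have hspec : ∀ γ ∈ Ico (0 : ℝ) 1, ∃ G, g γ = BPSK.invFT G ∧
      BPSK.IsSpectrum ((1 + γ) / (2 * T)) G ∧
      (∀ᵐ ν ∂volume.restrict (Icc (-((1 + γ) / (2 * T))) ((1 + γ) / (2 * T))), G ν ≠ 0) ∧
      s γ = BPSK.pulseSignal ha T (Te γ) G := by
    intro γ hγ
    obtain ⟨-, G, hG, hG0⟩ := hg γ hγ
    refine ⟨G, hG.eq_invFT, hG.isSpectrum, hG0, ?_⟩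
    rw [hs, hG.eq_invFT]
    rfl
  have hglb : ∀ γ ∈ Ico (0 : ℝ) 1,
      IsGLB (BPSK.betaPrime (Te γ / T) '' BPSK.unitFiltered (s γ)) (βmin γ) ∧
      IsGLB (BPSK.avgCum4 '' BPSK.unitFiltered (s γ)) (ηmin γ) ∧
      IsGLB (BPSK.PhiPrime T '' (BPSK.bandLimited (BPSK.band T γ) \ {0})) (βmin γ) ∧
      IsGLB (BPSK.Psi T '' (BPSK.bandLimited (BPSK.band T γ) \ {0})) (ηmin γ) := by
    intro γ hγ
    obtain ⟨G, -, hG, hG0, hsG⟩ := hspec γ hγ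
    have h := hsamp γ hγ
    have hne := BPSK.bandLimited_diff_nonempty h.b_pos hG hG0
    have e1 := ha.image_betaPrime_unitFiltered h hG hG0
    have e2 := ha.image_avgCum4_unitFiltered h hG hG0
    have g1 := isGLB_csInf (hne.image (BPSK.PhiPrime T))
      (BPSK.bddBelow_PhiPrime h.b_pos hT h.excess)
    have g2 := isGLB_csInf (hne.image (BPSK.Psi T)) (BPSK.bddBelow_Psi h.b_pos hT h.excess)
    rw [hβmin, hηmin, BPSK.betaPrimeMin, BPSK.etaMin, hsG, e1, e2]
    exact ⟨g1, g2, g1, g2⟩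
  have hanti : AntitoneOn βmin (Ico (0 : ℝ) 1) := by
    intro γ hγ γ' hγ' hle
    -- The signals for different `γ` are unrelated; the comparison goes through the band-limited
    -- functions, whose spaces are nested.
    refine (hglb γ hγ).2.2.1.mono (hglb γ' hγ').2.2.1 (image_mono (sdiff_subset_sdiff_left
      (BPSK.bandLimited_mono (Icc_subset_Icc ?_ ?_))))
    · gcongr
    · gcongr
  have h01 : (0 : ℝ) ∈ Ico (0 : ℝ) 1 := by simp
  refine ⟨fun γ hγ => ⟨fun t => ?_, ?_, fun r hr => ?_, (hglb γ hγ).1, (hglb γ hγ).2.1⟩,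
    fun γ hγ => (hglb γ hγ).2.2, hanti, ?_, fun h => h 0 h01, fun h γ hγ =>
      (hanti h01 hγ hγ.1).trans_lt h⟩
  · obtain ⟨G, hgG, hG, -, -⟩ := hspec γ hγ
    rw [hgG]
    exact ha.summable_smul_symbol (hG.summable_normSq_lattice (hsamp γ hγ).b_pos hT t)
  · obtain ⟨G, -, hG, -, hsG⟩ := hspec γ hγ
    rw [hsG]
    exact (ha.isSpectralDensity_pulseDensity (hsamp γ hγ) hG).spectralDensity
  · obtain ⟨G, -, hG, hG0, hsG⟩ := hspec γ hγ
    have h := hsamp γ hγ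
    rw [hsG, ha.unitFiltered_pulseSignal h hG hG0] at hr
    obtain ⟨F, hF, -, rfl⟩ := hr
    exact ha.betaPrimeExists_pulseSignal h.b_pos hT h.excess hF h.generic
  · have h := hsamp 0 h01
    have g1 := (hglb 0 h01).2.2.1
    have g2 := (hglb 0 h01).2.2.2
    have key : ∀ f ∈ BPSK.bandLimited (BPSK.band T 0) \ {0},
        BPSK.PhiPrime T f = BPSK.Psi T f + 2 := by
      rintro f ⟨⟨-, F, hF⟩, -⟩
      rw [BPSK.HasSpectrumIn.eq_invFT hF]
      -- At `γ = 0` the half-width is `1 / (2 * T)`, the equality case of `2 * b * T ≤ 1`.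
      exact (BPSK.HasSpectrumIn.isSpectrum hF).PhiPrime_eq_of_le h.b_pos hT
        (le_of_eq (by field_simp; norm_num))
    have e : BPSK.PhiPrime T '' (BPSK.bandLimited (BPSK.band T 0) \ {0}) =
        (fun y => y + 2) '' (BPSK.Psi T '' (BPSK.bandLimited (BPSK.band T 0) \ {0})) := by
      rw [image_image]
      exact image_congr key
    rw [e] at g1
    exact g1.unique ((OrderIso.addRight (2 : ℝ)).isGLB_image'.2 g2)
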